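/- All graphs are finite and have no loops or parallel edges. A graph $G$ has an odd hole if some induced subgraph of $G$ is a cycle of odd length at least $5$. Let $\chi(G)$ denote the chromatic number of $G$, and let $\omega(G)$ denote the largest cardinality of a clique (a set of pairwise adjacent vertices) of $G$. Then every graph $G$ with no odd hole satisfies $$\chi(G)\le 2^{2^{\omega(G)+2}}.$$ -/

import Mathlib

/-- `G` has an odd hole: an induced subgraph of `G` is a cycle of odd length at least five. -/
def SimpleGraph.HasOddHole {V : Type*} (G : SimpleGraph V) : Prop :=
  ∃ n : ℕ, 5 ≤ n ∧ Odd n ∧ (SimpleGraph.cycleGraph n).IsIndContained G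

/-!
A graph without odd holes has chromatic number at most `2 ^ 2 ^ (ω + 2)`. The proof is by induction
on the clique number `ω`: if sets without a clique of size `ω` are `n`-colourable, then the graph is
`32 ω n²`-colourable (`SimpleGraph.setColorable_univ_step`), and the resulting recursion is doubly
exponential (`SimpleGraph.holeBound_le`).

Let `J` be a symmetric relation without an induced path on four elements. Such a relation has two
elements that no third one distinguishes (`P4Free.exists_twins`). Suppose that a set `B` of vertices
is covered by neighbourhoods of vertices `a ∈ X`, and that `J` on `X` governs how vertices of `B`
attach to two members of `X`. Merging twins repeatedly produces a bipartition of `B` both sides of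
which meet every clique of size `ω` (`SimpleGraph.IsCover.exists_bipartition`), so `B` is
`2n`-colourable.

Such a relation comes from parity. Divide the graph into levels by distance from a root and let `X`
be a stable set on one level. Two vertices of `X` are joined by induced paths through the lower
levels; as there is no odd hole and these paths close up through higher levels, all of them have
the same parity, and `J` holds when it is odd (`SimpleGraph.Tower.J_iff`). The attachment rules for
`B`, above `X`, are again the absence of odd holes. What has to be arranged is that `J` has no
induced four-vertex path. For this, the levels are thinned out to minimal covers, so that every
vertex has a private child; a path of private children (the spine) is chosen; and vertices attached
to the spine are sorted into four types, by their neighbours on it and the parity of their level. A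
`SimpleGraph.Tower` is a part of the graph in which only one type occurs. In a tower, adjacent
vertices of a level (other than the last one) are attached alike to the levels below
(`SimpleGraph.Tower.sib_of_adj`), between neighbours and non-neighbours of the spine `J` is constant
(`SimpleGraph.Tower.J_near_iff`), and elsewhere `J` is inherited from parents
(`SimpleGraph.Tower.p4Free_J_step`). Hence `J` has no induced four-vertex path
(`SimpleGraph.Tower.p4Free_J`).

The last level of a tower then breaks into boundedly many stable sets to which the colouring result
applies: its vertices on the spine's neighbourhood have a common neighbour, and the others are
dominated by the level before, which induces a graph without four-vertex paths and so is perfect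
(`SimpleGraph.Tower.setColorable_F`).
-/


/-! ### Colourings of vertex sets -/

namespace SimpleGraph

variable {V : Type*} {G : SimpleGraph V}

/-- The subgraph induced on `X` is `q`-colourable; the colouring is encoded as a function on all
vertices, of which only the values on `X` matter. -/
def SetColorable (G : SimpleGraph V) (X : Set V) (q : ℕ) : Prop :=
  ∃ c : V → ℕ, (∀ x ∈ X, c x < q) ∧ ∀ x ∈ X, ∀ y ∈ X, G.Adj x y → c x ≠ c y

/-- Every clique inside `X` has fewer than `w` vertices. -/
def SmallCliques (G : SimpleGraph V) (w : ℕ) (X : Set V) : Prop :=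
  ∀ K : Finset V, ↑K ⊆ X → G.IsClique K → K.card < w

lemma SmallCliques.mono {w : ℕ} {X Y : Set V} (h : G.SmallCliques w Y) (hXY : X ⊆ Y) :
    G.SmallCliques w X :=
  fun K hK => h K (hK.trans hXY)

lemma SetColorable.mono {X Y : Set V} {q r : ℕ} (h : G.SetColorable Y q) (hXY : X ⊆ Y)
    (hqr : q ≤ r) : G.SetColorable X r := by
  obtain ⟨c, h1, h2⟩ := h
  exact ⟨c, fun x hx => (h1 x (hXY hx)).trans_le hqr,
    fun x hx y hy => h2 x (hXY hx) y (hXY hy)⟩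

lemma SetColorable.union {X Y : Set V} {q r : ℕ} (hX : G.SetColorable X q)
    (hY : G.SetColorable Y r) : G.SetColorable (X ∪ Y) (q + r) := by
  classical
  obtain ⟨c, h1, h2⟩ := hX
  obtain ⟨e, h3, h4⟩ := hY
  refine ⟨fun v => if v ∈ X then c v else q + e v, ?_, ?_⟩
  · rintro x hx
    by_cases hxX : x ∈ X
    · have := h1 x hxX
      simp only [hxX, if_true]; omega
    · have := h3 x (hx.resolve_left hxX)
      simp only [hxX, if_false]; omega
  · rintro x hx y hy hxy
    by_cases hxX : x ∈ X <;> by_cases hyX : y ∈ X <;> simp only [hxX, hyX, if_true, if_false]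
    · exact h2 x hxX y hyX hxy
    · have := h1 x hxX; omega
    · have := h1 y hyX; omega
    · have := h4 x (hx.resolve_left hxX) y (hy.resolve_left hyX) hxy; omega

lemma setColorable_empty : G.SetColorable ∅ 0 := ⟨fun _ => 0, by simp, by simp⟩

lemma SetColorable.of_iUnion {X : Set V} {m q : ℕ} {Y : ℕ → Set V}
    (hX : ∀ x ∈ X, ∃ j < m, x ∈ Y j) (hY : ∀ j < m, G.SetColorable (Y j) q) :
    G.SetColorable X (m * q) := by
  induction m generalizing X with
  | zero =>
    refine setColorable_empty.mono (fun x hx => ?_) (by simp)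
    obtain ⟨j, hj, -⟩ := hX x hx
    omega
  | succ m ih =>
    have h1 : G.SetColorable {x ∈ X | ∃ j < m, x ∈ Y j} (m * q) :=
      ih (fun x hx => hx.2) fun j hj => hY j (by omega)
    refine (h1.union (hY m (by omega))).mono (fun x hx => ?_) (by rw [Nat.succ_mul])
    obtain ⟨j, hj, hxj⟩ := hX x hx
    rcases Nat.lt_succ_iff_lt_or_eq.1 hj with h | rfl
    · exact Or.inl ⟨hx, j, h, hxj⟩
    · exact Or.inr hxj

/-- If the colour classes of a colouring of `A` each dominate a `q`-colourable part of `F`, then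
the whole part of `F` dominated by `A` is colourable with a product number of colours. -/
lemma SetColorable.dominated {A F : Set V} {m q : ℕ} (hA : G.SetColorable A m)
    (h : ∀ X ⊆ A, (∀ x ∈ X, ∀ y ∈ X, ¬ G.Adj x y) →
      G.SetColorable {f ∈ F | ∃ a ∈ X, G.Adj a f} q) :
    G.SetColorable {f ∈ F | ∃ a ∈ A, G.Adj a f} (m * q) := by
  obtain ⟨c, h1, h2⟩ := hA
  refine SetColorable.of_iUnion (Y := fun j => {f ∈ F | ∃ a ∈ {a ∈ A | c a = j}, G.Adj a f}) ?_ ?_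
  · rintro f ⟨hf, a, ha, haf⟩
    exact ⟨c a, h1 a ha, hf, a, ⟨ha, rfl⟩, haf⟩
  · intro j _
    refine h _ (fun a ha => ha.1) ?_
    rintro x ⟨hx, hxj⟩ y ⟨hy, hyj⟩ hxy
    exact h2 x hx y hy hxy (hxj.trans hyj.symm)

/-! ### Joining vertices inside a set -/

/-- `a` and `b` are joined by a walk all of whose vertices, except possibly `a` when `a = b`, lie
in `U`. -/
def Joined (G : SimpleGraph V) (U : Set V) : V → V → Prop :=
  Relation.ReflTransGen fun x y => G.Adj x y ∧ x ∈ U ∧ y ∈ U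

lemma Joined.refl {U : Set V} (a : V) : G.Joined U a a := Relation.ReflTransGen.refl

lemma Joined.symm {U : Set V} {a b : V} (h : G.Joined U a b) : G.Joined U b a := by
  induction h with
  | refl => exact Relation.ReflTransGen.refl
  | tail _ h ih => exact (Relation.ReflTransGen.single ⟨h.1.symm, h.2.2, h.2.1⟩).trans ih

lemma Joined.trans {U : Set V} {a b c : V} (h : G.Joined U a b) (h' : G.Joined U b c) :
    G.Joined U a c := Relation.ReflTransGen.trans h h'

lemma Joined.of_adj {U : Set V} {a b : V} (h : G.Adj a b) (ha : a ∈ U) (hb : b ∈ U) :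
    G.Joined U a b := Relation.ReflTransGen.single ⟨h, ha, hb⟩

lemma Joined.mono {U U' : Set V} {a b : V} (h : G.Joined U a b) (hU : U ⊆ U') :
    G.Joined U' a b := by
  induction h with
  | refl => exact Relation.ReflTransGen.refl
  | tail _ h ih => exact ih.tail ⟨h.1, hU h.2.1, hU h.2.2⟩

lemma Joined.mem {U : Set V} {a b : V} (h : G.Joined U a b) (ha : a ∈ U) : b ∈ U := by
  induction h with
  | refl => exact ha
  | tail _ h _ => exact h.2.2

/-- A set is colourable as soon as each of its connected components is. -/
lemma SetColorable.of_components {X : Set V} {q : ℕ}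
    (h : ∀ a ∈ X, G.SetColorable {x ∈ X | G.Joined X a x} q) : G.SetColorable X q := by
  classical
  let S : Setoid V := ⟨G.Joined X, Joined.refl, Joined.symm, Joined.trans⟩
  let r : V → V := fun x => (Quotient.mk S x).out
  have hr : ∀ x, G.Joined X (r x) x := fun x => Quotient.mk_out (s := S) x
  have hrX : ∀ x ∈ X, r x ∈ X := fun x hx => (hr x).symm.mem hx
  have hr2 : ∀ x y, G.Joined X x y → r x = r y := fun x y hxy => by
    simp only [r]; rw [Quotient.sound (s := S) hxy]
  choose! c hc1 hc2 using h
  refine ⟨fun x => c (r x) x, fun x hx => hc1 _ (hrX x hx) x ⟨hx, hr x⟩, ?_⟩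
  intro x hx y hy hxy
  have e := hr2 x y (Joined.of_adj hxy hx hy)
  simp only [e]
  exact hc2 _ (hrX y hy) x ⟨hx, e ▸ hr x⟩ y ⟨hy, hr y⟩ hxy

/-! ### Induced paths and odd holes -/

/-- `x` and `y` are distinct and nonadjacent. -/
def Far (G : SimpleGraph V) (x y : V) : Prop := x ≠ y ∧ ¬ G.Adj x y

lemma Far.symm {x y : V} (h : G.Far x y) : G.Far y x := ⟨h.1.symm, fun e => h.2 e.symm⟩

/-- There is an induced path with `l` edges from `x` to `y` all of whose interior vertices lie
in `U`; the path is the restriction of a sequence of vertices to the indices up to `l`. -/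
def IndPath (G : SimpleGraph V) (U : Set V) (l : ℕ) (x y : V) : Prop :=
  ∃ f : ℕ → V, f 0 = x ∧ f l = y ∧
    (∀ i j, i < j → j ≤ l → f i ≠ f j ∧ (G.Adj (f i) (f j) ↔ j = i + 1)) ∧
    ∀ i, 0 < i → i < l → f i ∈ U

lemma IndPath.mono {U U' : Set V} {l : ℕ} {x y : V} (h : G.IndPath U l x y) (hU : U ⊆ U') :
    G.IndPath U' l x y := by
  obtain ⟨f, h0, h1, h2, h3⟩ := h
  exact ⟨f, h0, h1, h2, fun i hi hi' => hU (h3 i hi hi')⟩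

lemma IndPath.symm {U : Set V} {l : ℕ} {x y : V} (h : G.IndPath U l x y) :
    G.IndPath U l y x := by
  obtain ⟨f, h0, h1, h2, h3⟩ := h
  refine ⟨fun i => f (l - i), by simpa, by simpa, fun i j hij hj => ?_, fun i hi hi' =>
    h3 _ (by omega) (by omega)⟩
  have := h2 (l - j) (l - i) (by omega) (by omega)
  refine ⟨this.1.symm, ?_⟩
  rw [G.adj_comm, this.2]
  omega

lemma IndPath.of_adj {x y : V} (h : G.Adj x y) (U : Set V) : G.IndPath U 1 x y := by
  refine ⟨fun i => if i = 0 then x else y, by simp, by simp, fun i j hij hj => ?_, fun i hi hi' =>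
    by omega⟩
  obtain ⟨rfl, rfl⟩ : i = 0 ∧ j = 1 := by omega
  simp [h, h.ne]

/-- Prepend a vertex to an induced path. -/
lemma IndPath.cons {U : Set V} {l : ℕ} {x p y : V} (h : G.IndPath U l p y) (hxp : G.Adj x p)
    (hxy : G.Far x y) (hU : ∀ u ∈ U, G.Far x u) : G.IndPath (insert p U) (l + 1) x y := by
  obtain ⟨f, h0, h1, h2, h3⟩ := h
  have hx : ∀ j, 0 < j → j ≤ l → G.Far x (f j) := by
    intro j hj hjl
    rcases hjl.lt_or_eq with h | rfl
    · exact hU _ (h3 j hj h)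
    · exact h1 ▸ hxy
  refine ⟨fun i => if i = 0 then x else f (i - 1), by simp, by simpa, fun i j hij hj => ?_,
    fun i hi hi' => ?_⟩
  · have hj0 : j ≠ 0 := by omega
    rcases Nat.eq_zero_or_pos i with rfl | hi
    · simp only [if_true, hj0, if_false]
      rcases eq_or_ne j 1 with rfl | hj1
      · simp [h0, hxp, hxp.ne]
      · have := hx (j - 1) (by omega) (by omega)
        exact ⟨this.1, iff_of_false this.2 (by omega)⟩
    · have hi0 : i ≠ 0 := by omega
      simp only [hi0, hj0, if_false]
      have := h2 (i - 1) (j - 1) (by omega) (by omega)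
      refine ⟨this.1, this.2.trans (by omega)⟩
  · have hi0 : i ≠ 0 := by omega
    simp only [hi0, if_false]
    rcases eq_or_ne i 1 with rfl | hi1
    · simp [h0]
    · exact Or.inr (h3 _ (by omega) (by omega))

/-- Append a vertex to an induced path. -/
lemma IndPath.snoc {U : Set V} {l : ℕ} {x p y : V} (h : G.IndPath U l x p) (hpy : G.Adj p y)
    (hxy : G.Far x y) (hU : ∀ u ∈ U, G.Far u y) : G.IndPath (insert p U) (l + 1) x y :=
  (h.symm.cons hpy.symm hxy.symm fun u hu => (hU u hu).symm).symm

lemma IndPath.two {x p y : V} (hxp : G.Adj x p) (hpy : G.Adj p y) (hxy : G.Far x y) :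
    G.IndPath {p} 2 x y := by
  have := (IndPath.of_adj hpy ∅).cons hxp hxy (by simp)
  simpa using this

lemma IndPath.two_le {U : Set V} {l : ℕ} {x y : V} (h : G.IndPath U l x y) (hxy : G.Far x y) :
    2 ≤ l := by
  obtain ⟨f, h0, h1, h2, -⟩ := h
  by_contra hl
  obtain rfl | rfl : l = 0 ∨ l = 1 := by omega
  · exact hxy.1 (h0.symm.trans h1)
  · exact hxy.2 (by rw [← h0, ← h1]; exact (h2 0 1 one_pos le_rfl).2.2 rfl)

lemma IndPath.eq_zero {U : Set V} {l : ℕ} {x : V} (h : G.IndPath U l x x) : l = 0 := by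
  obtain ⟨f, h0, h1, h2, -⟩ := h
  by_contra hl
  exact (h2 0 l (by omega) le_rfl).1 (h0.trans h1.symm)

/-- An induced path can be lengthened by one more vertex, after cutting it at its first contact
with that vertex. -/
lemma IndPath.extend {U : Set V} {l : ℕ} {x b c : V} (h : G.IndPath U l x b) (hb : b ∈ U)
    (hbc : G.Adj b c) : ∃ l', G.IndPath U l' x c := by
  classical
  obtain ⟨f, h0, h1, h2, h3⟩ := h
  have hex : ∃ i, i ≤ l ∧ (G.Adj (f i) c ∨ f i = c) := ⟨l, le_rfl, Or.inl (h1 ▸ hbc)⟩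
  obtain ⟨hil, hi⟩ := Nat.find_spec hex
  set i := Nat.find hex with hidef
  have hmin : ∀ j, j < i → G.Far (f j) c := fun j hj => by
    have := Nat.find_min hex hj
    push Not at this
    exact ⟨(this (by omega)).2, (this (by omega)).1⟩
  have hU : ∀ j, 0 < j → j ≤ l → f j ∈ U := fun j hj hjl => by
    rcases hjl.lt_or_eq with h | rfl
    · exact h3 j hj h
    · exact h1 ▸ hb
  rcases hi with hi | hi
  · refine ⟨i + 1, fun j => if j ≤ i then f j else c, by simp [h0], by simp, ?_, ?_⟩
    · intro j m hjm hm
      rcases Nat.lt_or_ge i m with him | him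
      · obtain rfl : m = i + 1 := by omega
        have hji : j ≤ i := by omega
        simp only [hji, if_true, Nat.not_succ_le_self, if_false]
        rcases hji.lt_or_eq with hlt | rfl
        · exact ⟨(hmin j hlt).1, iff_of_false (hmin j hlt).2 (by omega)⟩
        · exact ⟨hi.ne, iff_of_true hi rfl⟩
      · have hji : j ≤ i := by omega
        simp only [hji, him, if_true]
        exact h2 j m hjm (by omega)
    · intro j hj hji
      have hji : j ≤ i := by omega
      simp only [hji, if_true]
      exact hU j hj (by omega)
  · refine ⟨i, f, h0, hi, fun j m hjm hm => h2 j m hjm (by omega), fun j hj hji =>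
      hU j hj (by omega)⟩

/-- Two vertices with neighbours in the same connected part of `U` are the ends of an induced path
with interior in `U`. -/
lemma Joined.exists_indPath {U : Set V} {a b x y : V} (h : G.Joined U a b) (ha : a ∈ U)
    (hxa : G.Adj x a) (hby : G.Adj b y) :
    ∃ l, G.IndPath U l x y := by
  have key : ∀ b, G.Joined U a b → ∃ l, G.IndPath U l x b := by
    intro b hb
    induction hb with
    | refl => exact ⟨1, IndPath.of_adj hxa U⟩
    | @tail b c hab hbc ih =>
      obtain ⟨l, hl⟩ := ih
      exact hl.extend hbc.2.1 hbc.1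
  obtain ⟨l, hl⟩ := key b h
  exact hl.extend (h.mem ha) hby

lemma HasOddHole.of_cyclic_sequence {m : ℕ} (hm : 5 ≤ m) (hodd : Odd m) (h : ℕ → V)
    (hh : ∀ i j, i < j → j < m →
      h i ≠ h j ∧ (G.Adj (h i) (h j) ↔ j = i + 1 ∨ (i = 0 ∧ j + 1 = m))) : G.HasOddHole := by
  refine ⟨m, hm, hodd, ⟨⟨⟨fun i => h i.val, ?_⟩, ?_⟩⟩⟩
  · intro i j hij
    by_contra hne
    rcases lt_or_gt_of_ne (fun e => hne (Fin.ext e) : i.val ≠ j.val) with hlt | hlt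
    · exact (hh _ _ hlt j.2).1 hij
    · exact (hh _ _ hlt i.2).1 hij.symm
  · have key : ∀ i j : Fin m, i.val < j.val →
        (G.Adj (h i) (h j) ↔ (cycleGraph m).Adj i j) := by
      intro i j hij
      rw [(hh _ _ hij j.2).2, cycleGraph_adj', Fin.coe_sub_iff_lt.2 hij,
        Fin.sub_val_of_le hij.le]
      have := i.2
      have := j.2
      omega
    intro i j
    change G.Adj (h i) (h j) ↔ _
    rcases lt_trichotomy i.val j.val with hlt | heq | hlt
    · exact key i j hlt
    · obtain rfl := Fin.ext heq
      simp
    · rw [G.adj_comm, key j i hlt, adj_comm]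

/-- Two induced paths with the same far ends, whose interiors do not touch each other, form a hole;
so their lengths have the same parity if there is no odd hole. -/
lemma HasOddHole.of_indPaths {U U' : Set V} {p q : ℕ} {x y : V} (hp : G.IndPath U p x y)
    (hq : G.IndPath U' q x y) (hxy : G.Far x y) (hU : ∀ u ∈ U, ∀ u' ∈ U', G.Far u u')
    (hodd : Odd (p + q)) : G.HasOddHole := by
  have hp2 := hp.two_le hxy
  have hq2 := hq.two_le hxy
  obtain ⟨f, f0, f1, f2, f3⟩ := hp
  obtain ⟨g, g0, g1, g2, g3⟩ := hq
  refine HasOddHole.of_cyclic_sequence (m := p + q) (by rcases hodd with ⟨t, ht⟩; omega) hodd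
    (fun i => if i ≤ p then f i else g (p + q - i)) ?_
  intro i j hij hj
  rcases Nat.lt_or_ge p j with hpj | hpj
  · have hjp : ¬ j ≤ p := by omega
    rcases Nat.lt_or_ge p i with hpi | hpi
    · have hip : ¬ i ≤ p := by omega
      simp only [hip, hjp, if_false]
      have := g2 (p + q - j) (p + q - i) (by omega) (by omega)
      refine ⟨this.1.symm, ?_⟩
      rw [G.adj_comm, this.2]
      omega
    · simp only [hpi, hjp, if_true, if_false]
      rcases Nat.eq_zero_or_pos i with rfl | hi
      · have := g2 0 (p + q - j) (by omega) (by omega)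
        rw [f0, ← g0]
        refine ⟨this.1, this.2.trans (by omega)⟩
      · rcases hpi.lt_or_eq with hip | rfl
        · have := hU _ (f3 i hi hip) _ (g3 (p + q - j) (by omega) (by omega))
          exact ⟨this.1, iff_of_false this.2 (by omega)⟩
        · have := g2 (i + q - j) q (by omega) le_rfl
          rw [f1, ← g1]
          refine ⟨this.1.symm, ?_⟩
          rw [G.adj_comm, this.2]
          omega
  · have hpi : i ≤ p := by omega
    simp only [hpi, hpj, if_true]
    have := f2 i j hij hpj
    refine ⟨this.1, this.2.trans (by omega)⟩

end SimpleGraph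


/-! ### Relations without an induced path on four elements -/

/-- The relation `J` has no induced path on four elements of `X`. For symmetric `J` the four
elements of such a path are automatically distinct. -/
def P4Free {ι : Type*} (J : ι → ι → Prop) (X : Set ι) : Prop :=
  ∀ a ∈ X, ∀ b ∈ X, ∀ c ∈ X, ∀ d ∈ X,
    J a b → J b c → J c d → ¬ J a c → ¬ J b d → ¬ J a d → False

section P4Free

variable {ι : Type*} {J : ι → ι → Prop}

lemma P4Free.mono {X Y : Set ι} (h : P4Free J Y) (hXY : X ⊆ Y) : P4Free J X :=
  fun a ha b hb c hc d hd => h a (hXY ha) b (hXY hb) c (hXY hc) d (hXY hd)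

/-- The complement of a path on four elements is again such a path. -/
lemma P4Free.compl (hJ : ∀ a b, J a b → J b a) {X : Set ι} (h : P4Free J X) :
    P4Free (fun a b => ¬ J a b) X := by
  intro a ha b hb c hc d hd h1 h2 h3 h4 h5 h6
  simp only [not_not] at h4 h5 h6
  exact h c hc a ha d hd b hb (hJ _ _ h4) h6 (hJ _ _ h5) h3 h1 fun e => h2 (hJ _ _ e)

variable [DecidableEq ι]

/-- `Y` and `Z` partition `X` into two nonempty parts between which `J` is constant. -/
structure IsSplit (J : ι → ι → Prop) (X Y Z : Finset ι) : Prop where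
  left : Y.Nonempty
  right : Z.Nonempty
  disj : Disjoint Y Z
  union : Y ∪ Z = X
  homog : (∀ y ∈ Y, ∀ z ∈ Z, J y z) ∨ ∀ y ∈ Y, ∀ z ∈ Z, ¬ J y z

lemma IsSplit.of_compl {X Y Z : Finset ι} (h : IsSplit (fun a b => ¬ J a b) X Y Z) :
    IsSplit J X Y Z :=
  ⟨h.left, h.right, h.disj, h.union, by simpa using h.homog.symm⟩

/-- The case of `P4Free.exists_isSplit` in which a disconnected set is extended by one element. -/
lemma P4Free.exists_isSplit_insert (hJ : ∀ a b, J a b → J b a) {X : Finset ι} {v : ι} (hv : v ∉ X)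
    (h : P4Free J ↑(insert v X)) {Y₀ : Finset ι} (hY₀ : Y₀ ⊆ X) (hne : Y₀.Nonempty)
    (hne' : (X \ Y₀).Nonempty) (hanti : ∀ y ∈ Y₀, ∀ z ∈ X \ Y₀, ¬ J y z) :
    ∃ Y Z, IsSplit J (insert v X) Y Z := by
  classical
  by_cases hall : ∀ x ∈ X, J v x
  · exact ⟨{v}, X, by simp, hne.mono hY₀, by simpa, rfl, by simpa using Or.inl hall⟩
  push Not at hall
  obtain ⟨y₀, hy₀, hvy₀⟩ := hall
  -- a minimal union of components of `X` that contains `y₀`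
  let P : Finset (Finset ι) :=
    X.powerset.filter fun Y => y₀ ∈ Y ∧ ∀ y ∈ Y, ∀ z ∈ X \ Y, ¬ J y z
  have hP : ∃ Y ∈ P, Y ≠ X := by
    by_cases hy : y₀ ∈ Y₀
    · refine ⟨Y₀, by simp only [P, Finset.mem_filter, Finset.mem_powerset]; exact ⟨hY₀, hy, hanti⟩,
        ?_⟩
      rintro rfl; simp at hne'
    · refine ⟨X \ Y₀, ?_, ?_⟩
      · simp only [P, Finset.mem_filter, Finset.mem_powerset]
        refine ⟨Finset.sdiff_subset, by simp [hy, hy₀], fun y hy z hz hyz => ?_⟩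
        refine hanti z ?_ y hy (hJ _ _ hyz)
        simp only [Finset.mem_sdiff, not_and, not_not] at hz
        exact hz.2 hz.1
      · obtain ⟨t, ht⟩ := hne
        intro e
        have := e ▸ hY₀ ht
        simp [ht] at this
  obtain ⟨Y₁, hY₁P, hY₁X⟩ := hP
  obtain ⟨Y, hYY₁, hYmin⟩ := P.exists_le_minimal hY₁P
  have hYP := hYmin.1
  simp only [P, Finset.mem_filter, Finset.mem_powerset] at hYP
  obtain ⟨hYX, hy₀Y, hYanti⟩ := hYP
  have hZne : (X \ Y).Nonempty := by
    rw [Finset.sdiff_nonempty]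
    intro hle
    have hY₁X' : Y₁ ⊆ X := by
      simp only [P, Finset.mem_filter, Finset.mem_powerset] at hY₁P; exact hY₁P.1
    exact hY₁X (hY₁X'.antisymm (hle.trans hYY₁))
  have hvY : v ∉ Y := fun e => hv (hYX e)
  by_cases h1 : ∀ z ∈ X \ Y, ¬ J v z
  · refine ⟨insert v Y, X \ Y, by simp, hZne, ?_, ?_, Or.inr ?_⟩
    · simp [Finset.disjoint_insert_left, hv, Finset.disjoint_sdiff]
    · simp [Finset.insert_union, Finset.union_eq_right.2 hYX]
    · intro y hy
      rcases Finset.mem_insert.1 hy with rfl | hy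
      · exact h1
      · exact hYanti y hy
  push Not at h1
  obtain ⟨z, hz, hvz⟩ := h1
  by_cases h2 : ∀ y ∈ Y, ¬ J v y
  · refine ⟨Y, insert v (X \ Y), ⟨_, hy₀Y⟩, by simp, ?_, ?_, Or.inr ?_⟩
    · simp [Finset.disjoint_insert_right, hvY, Finset.disjoint_sdiff]
    · simp [Finset.union_insert, Finset.union_eq_right.2 hYX]
    · intro y hy w hw
      rcases Finset.mem_insert.1 hw with rfl | hw
      · exact fun e => h2 y hy (hJ _ _ e)
      · exact hYanti y hy w hw
  push Not at h2
  obtain ⟨y₂, hy₂, hvy₂⟩ := h2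
  have hlt : ¬ ∀ y ∈ Y.filter (fun y => ¬ J v y), ∀ z ∈ X \ Y.filter (fun y => ¬ J v y),
      ¬ J y z := by
    intro hcon
    have : Y ⊆ Y.filter (fun y => ¬ J v y) := by
      refine hYmin.2 ?_ (Finset.filter_subset _ _)
      simp only [P, Finset.mem_filter (s := X.powerset), Finset.mem_powerset]
      exact ⟨(Finset.filter_subset _ _).trans hYX, by simp [hy₀Y, hvy₀], hcon⟩
    exact (Finset.mem_filter.1 (this hy₂)).2 hvy₂
  push Not at hlt
  obtain ⟨y, hy, x, hx, hyx⟩ := hlt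
  simp only [Finset.mem_filter, Finset.mem_sdiff, not_and, not_not] at hy hx hz
  have hxY : x ∈ Y := by
    by_contra hxY
    exact hYanti y hy.1 x (by simp [hx.1, hxY]) hyx
  exfalso
  refine h z ?_ v ?_ x ?_ y ?_ (hJ _ _ hvz) (hx.2 hxY) (hJ _ _ hyx) ?_ hy.2 ?_
  · simp [hz.1]
  · simp
  · simp [hx.1]
  · simp [hYX hy.1]
  · exact fun e => hYanti x hxY z (by simp [hz]) (hJ _ _ e)
  · exact fun e => hYanti y hy.1 z (by simp [hz]) (hJ _ _ e)

/-- A symmetric relation without induced four-element paths, or its complement, is disconnected. -/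
lemma P4Free.exists_isSplit (hJ : ∀ a b, J a b → J b a) {X : Finset ι} (h : P4Free J (X : Set ι))
    (hX : 2 ≤ X.card) : ∃ Y Z, IsSplit J X Y Z := by
  induction X using Finset.induction_on with
  | empty => simp at hX
  | insert v X hv ih =>
    rw [Finset.card_insert_of_notMem hv] at hX
    rcases Nat.lt_or_ge X.card 2 with h2 | h2
    · obtain ⟨u, rfl⟩ := Finset.card_eq_one.1 (by omega : X.card = 1)
      refine ⟨{v}, {u}, by simp, by simp, by simpa using hv, rfl, ?_⟩
      simpa using em (J v u)
    · obtain ⟨Y, Z, hYZ⟩ := ih (h.mono (by simp)) h2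
      have hsub : Y ⊆ X := hYZ.union ▸ Finset.subset_union_left
      have hZ : X \ Y = Z := by
        rw [← hYZ.union, Finset.union_sdiff_left, Finset.sdiff_eq_self_of_disjoint hYZ.disj.symm]
      rcases hYZ.homog with hc | hc
      · obtain ⟨Y', Z', h'⟩ := P4Free.exists_isSplit_insert (J := fun a b => ¬ J a b)
          (fun a b h e => h (hJ _ _ e)) hv (h.compl hJ) hsub hYZ.left (hZ ▸ hYZ.right)
          (by simpa [hZ] using hc)
        exact ⟨Y', Z', h'.of_compl⟩
      · exact P4Free.exists_isSplit_insert hJ hv h hsub hYZ.left (hZ ▸ hYZ.right) (hZ ▸ hc)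

lemma IsSplit.card_lt {X Y Z : Finset ι} (h : IsSplit J X Y Z) :
    Y.card < X.card ∧ Z.card < X.card := by
  rw [← h.union, Finset.card_union_of_disjoint h.disj]
  have := h.left.card_pos
  have := h.right.card_pos
  omega

/-- Two elements that no third element of `X` distinguishes. -/
lemma P4Free.exists_twins (hJ : ∀ a b, J a b → J b a) {X : Finset ι} (h : P4Free J (X : Set ι))
    (hX : 2 ≤ X.card) : ∃ a ∈ X, ∃ a' ∈ X, a ≠ a' ∧
      ∀ c ∈ X, c ≠ a → c ≠ a' → (J c a ↔ J c a') := by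
  induction hm : X.card using Nat.strong_induction_on generalizing X with
  | _ m ih =>
    subst hm
    obtain ⟨Y, Z, hs⟩ := h.exists_isSplit hJ hX
    have hYX : Y ⊆ X := hs.union ▸ Finset.subset_union_left
    have hZX : Z ⊆ X := hs.union ▸ Finset.subset_union_right
    have hmem : ∀ c ∈ X, c ∈ Y ∨ c ∈ Z := fun c hc => by rwa [← hs.union, Finset.mem_union] at hc
    rcases Nat.lt_or_ge Y.card 2 with hY | hY
    · rcases Nat.lt_or_ge Z.card 2 with hZ | hZ
      · obtain ⟨a, rfl⟩ := Finset.card_eq_one.1 (by have := hs.left.card_pos; omega : Y.card = 1)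
        obtain ⟨b, rfl⟩ := Finset.card_eq_one.1 (by have := hs.right.card_pos; omega : Z.card = 1)
        refine ⟨a, hYX (by simp), b, hZX (by simp), by simpa using hs.disj, fun c hc h1 h2 => ?_⟩
        rcases hmem c hc with h | h <;> simp_all
      · obtain ⟨a, ha, b, hb, hab, hc⟩ :=
          ih _ hs.card_lt.2 (h.mono (by exact_mod_cast hZX)) hZ rfl
        refine ⟨a, hZX ha, b, hZX hb, hab, fun c hcX h1 h2 => ?_⟩
        rcases hmem c hcX with h | h
        · rcases hs.homog with h' | h'
          · exact iff_of_true (h' c h a ha) (h' c h b hb)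
          · exact iff_of_false (h' c h a ha) (h' c h b hb)
        · exact hc c h h1 h2
    · obtain ⟨a, ha, b, hb, hab, hc⟩ :=
        ih _ hs.card_lt.1 (h.mono (by exact_mod_cast hYX)) hY rfl
      refine ⟨a, hYX ha, b, hYX hb, hab, fun c hcX h1 h2 => ?_⟩
      rcases hmem c hcX with h | h
      · exact hc c h h1 h2
      · rcases hs.homog with h' | h'
        · exact iff_of_true (hJ _ _ (h' a ha c h)) (hJ _ _ (h' b hb c h))
        · exact iff_of_false (fun e => h' a ha c h (hJ _ _ e)) fun e => h' b hb c h (hJ _ _ e)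

end P4Free

namespace SimpleGraph

variable {V : Type*} {G : SimpleGraph V}

lemma SetColorable.union_of_not_adj {X Y : Set V} {q r : ℕ} (hX : G.SetColorable X q)
    (hY : G.SetColorable Y r) (hXY : ∀ x ∈ X, ∀ y ∈ Y, ¬ G.Adj x y) (hd : Disjoint X Y) :
    G.SetColorable (X ∪ Y) (max q r) := by
  classical
  obtain ⟨c, h1, h2⟩ := hX
  obtain ⟨e, h3, h4⟩ := hY
  have hYX : ∀ y ∈ Y, y ∉ X := fun y hy hx => Set.disjoint_left.1 hd hx hy
  refine ⟨fun v => if v ∈ X then c v else e v, ?_, ?_⟩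
  · rintro x (hx | hx)
    · simpa [hx] using Or.inl (h1 x hx)
    · simpa [hYX x hx] using Or.inr (h3 x hx)
  · rintro x (hx | hx) y (hy | hy) hxy
    · simpa [hx, hy] using h2 x hx y hy hxy
    · exact absurd hxy (hXY x hx y hy)
    · exact absurd hxy.symm (hXY y hy x hx)
    · simpa [hYX x hx, hYX y hy] using h4 x hx y hy hxy

/-- Graphs without induced four-vertex paths are perfect. -/
lemma exists_isClique_setColorable_of_p4Free {X : Finset V} (h : P4Free G.Adj (X : Set V)) :
    ∃ K ⊆ X, G.IsClique (K : Set V) ∧ G.SetColorable X K.card := by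
  classical
  induction hm : X.card using Nat.strong_induction_on generalizing X with
  | _ m ih =>
    subst hm
    rcases Nat.lt_or_ge X.card 2 with hX | hX
    · refine ⟨X, subset_rfl, ?_, fun _ => 0, fun x hx => Finset.card_pos.2 ⟨x, hx⟩, ?_⟩
      · intro x hx y hy hxy
        exact absurd (Finset.card_le_one.1 (by omega) x hx y hy) hxy
      · intro x hx y hy hxy
        exact absurd (Finset.card_le_one.1 (by omega) x hx y hy) hxy.ne
    · obtain ⟨Y, Z, hs⟩ := h.exists_isSplit (fun a b h => h.symm) hX
      have hYX : Y ⊆ X := hs.union ▸ Finset.subset_union_left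
      have hZX : Z ⊆ X := hs.union ▸ Finset.subset_union_right
      obtain ⟨K, hK, hKc, hKq⟩ := ih _ hs.card_lt.1 (h.mono (by exact_mod_cast hYX)) rfl
      obtain ⟨L, hL, hLc, hLq⟩ := ih _ hs.card_lt.2 (h.mono (by exact_mod_cast hZX)) rfl
      have hU : (X : Set V) = ↑Y ∪ ↑Z := by rw [← hs.union]; simp
      rcases hs.homog with hc | hc
      · refine ⟨K ∪ L, Finset.union_subset (hK.trans hYX) (hL.trans hZX), ?_, ?_⟩
        · intro x hx y hy hxy
          simp only [Finset.coe_union, Set.mem_union, Finset.mem_coe] at hx hy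
          rcases hx with hx | hx <;> rcases hy with hy | hy
          · exact hKc hx hy hxy
          · exact hc x (hK hx) y (hL hy)
          · exact (hc y (hK hy) x (hL hx)).symm
          · exact hLc hx hy hxy
        · rw [Finset.card_union_of_disjoint (hs.disj.mono hK hL), hU]
          exact hKq.union hLq
      · have := hKq.union_of_not_adj hLq (by simpa using hc) (by exact_mod_cast hs.disj)
        rw [← hU] at this
        rcases le_total K.card L.card with hle | hle
        · exact ⟨L, hL.trans hZX, hLc, by rwa [max_eq_right hle] at this⟩
        · exact ⟨K, hK.trans hYX, hKc, by rwa [max_eq_left hle] at this⟩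

/-! ### Splitting the maximum cliques of a set covered by neighbourhoods -/

/-- A cover of `B` by sets `N a`, indexed by `a ∈ X`, controlled by a relation `J` on the indices:
the pattern in which two vertices of `B` may be attached to two indices depends on `J`. -/
structure IsCover {ι : Type*} (G : SimpleGraph V) (w : ℕ) (X : Finset ι) (J : ι → ι → Prop)
    (N : ι → Set V) (B : Set V) : Prop where
  cover : ∀ b ∈ B, ∃ a ∈ X, b ∈ N a
  disj : ∀ a ∈ X, ∀ c ∈ X, J a c → ∀ b ∈ B, b ∈ N a → b ∉ N c
  edge : ∀ a ∈ X, ∀ c ∈ X, a ≠ c → ¬ J a c → ∀ b ∈ B, ∀ b' ∈ B, G.Adj b b' →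
    b ∈ N a → b ∉ N c → b' ∈ N c → b' ∈ N a
  path : ∀ a ∈ X, ∀ c ∈ X, J a c → ∀ b₁ ∈ B, ∀ b₂ ∈ B, ∀ b₃ ∈ B, G.Adj b₁ b₂ → G.Adj b₂ b₃ →
    ¬ G.Adj b₁ b₃ → b₁ ∈ N a → b₁ ∉ N c → b₃ ∈ N c → b₃ ∉ N a → b₂ ∉ N a → b₂ ∈ N c
  small : ∀ a ∈ X, G.SmallCliques w (N a ∩ B)

section IsCover

variable {ι : Type*} {w : ℕ} {X : Finset ι} {J : ι → ι → Prop} {N : ι → Set V} {B : Set V}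

lemma exists_not_adj_of_card_eq {K : Finset V} (hw : ∀ K : Finset V, G.IsClique (K : Set V) →
    K.card ≤ w) (hK : G.IsClique (K : Set V)) (hKw : K.card = w) {b : V} (hb : b ∉ K) :
    ∃ z ∈ K, ¬ G.Adj b z := by
  classical
  by_contra! hcon
  have := hw (insert b K) (by
    rw [Finset.coe_insert, isClique_insert]
    exact ⟨hK, fun z hz _ => hcon z hz⟩)
  rw [Finset.card_insert_of_notMem hb] at this
  omega

/-- If `a` and `a'` are `J`-related twins, then a maximum clique meeting, in a vertex of `N a`,
another maximum clique inside `N a ∪ N a'` is itself inside `N a ∪ N a'`. -/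
lemma IsCover.mem_union_of_twins (h : G.IsCover w X J N B) (hJ : ∀ a b, J a b → J b a)
    (hw : ∀ K : Finset V, G.IsClique (K : Set V) → K.card ≤ w) {a a' : ι} (ha : a ∈ X)
    (ha' : a' ∈ X) (haa : J a a')
    (htw : ∀ c ∈ X, c ≠ a → c ≠ a' → (J c a ↔ J c a')) {K K' : Finset V}
    (hK : G.IsClique (K : Set V)) (hKw : K.card = w) (hKB : (K : Set V) ⊆ B)
    (hKN : ∀ x ∈ K, x ∈ N a ∨ x ∈ N a') (hK' : G.IsClique (K' : Set V))
    (hKB' : (K' : Set V) ⊆ B) {y : V} (hyK : y ∈ K) (hyK' : y ∈ K') (hya : y ∈ N a) {b : V}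
    (hb : b ∈ K') : b ∈ N a ∨ b ∈ N a' := by
  by_contra hcon
  push Not at hcon
  obtain ⟨hba, hba'⟩ := hcon
  have hbB := hKB' hb
  obtain ⟨c, hc, hbc⟩ := h.cover b hbB
  have hca : c ≠ a := by rintro rfl; exact hba hbc
  have hca' : c ≠ a' := by rintro rfl; exact hba' hbc
  have hby : G.Adj b y := hK' hb hyK' (by rintro rfl; exact hba hya)
  have hbK : b ∉ K := fun e => by rcases hKN b e with h | h <;> contradiction
  obtain ⟨z, hzK, hbz⟩ := exists_not_adj_of_card_eq hw hK hKw hbK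
  have hKa : ∃ x ∈ K, x ∉ N a := by
    by_contra! hall
    have := h.small a ha K (fun x hx => ⟨hall x hx, hKB hx⟩) hK
    omega
  obtain ⟨x, hxK, hxa⟩ := hKa
  have hxa' := (hKN x hxK).resolve_left hxa
  have hyx : G.Adj y x := hK hyK hxK (by rintro rfl; exact hxa hya)
  have hyB := hKB hyK
  have hxB := hKB hxK
  have hzB := hKB hzK
  have hya' := h.disj a ha a' ha' haa y hyB hya
  by_cases hJ' : J c a
  · have hJa' := (htw c hc hca hca').1 hJ'
    have dis : ∀ v ∈ K, v ∉ N c := by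
      intro v hv hvc
      rcases hKN v hv with hva | hva
      · exact h.disj c hc a ha hJ' v (hKB hv) hvc hva
      · exact h.disj c hc a' ha' hJa' v (hKB hv) hvc hva
    have hex : ∃ x₂ ∈ K, x₂ ∈ N a' ∧ G.Adj b x₂ := by
      by_contra! hall
      exact dis y hyK (by_contra fun _ => hya' (h.path c hc a' ha' hJa' b hbB y hyB x hxB hby hyx
        (hall x hxK hxa') hbc hba' hxa' (dis x hxK) (dis y hyK)))
    obtain ⟨x₂, hx₂K, hx₂a', hbx₂⟩ := hex
    rcases hKN z hzK with hz | hz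
    · have hx₂a : x₂ ∉ N a := fun e => h.disj a ha a' ha' haa x₂ (hKB hx₂K) e hx₂a'
      exact hx₂a (h.path c hc a ha hJ' b hbB x₂ (hKB hx₂K) z hzB hbx₂
        (hK hx₂K hzK (by rintro rfl; exact hx₂a hz)) hbz hbc hba hz (dis z hzK) (dis x₂ hx₂K))
    · exact hya' (h.path c hc a' ha' hJa' b hbB y hyB z hzB hby
        (hK hyK hzK (by rintro rfl; exact hya' hz)) hbz hbc hba' hz (dis z hzK) (dis y hyK))
  · have hJa' : ¬ J c a' := fun e => hJ' ((htw c hc hca hca').2 e)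
    have hyc : y ∈ N c := by
      by_contra hyc
      exact hba (h.edge a ha c hc hca.symm (fun e => hJ' (hJ _ _ e)) y hyB b hbB hby.symm hya hyc
        hbc)
    have key : ∀ u ∈ K, u ∈ N a' → u ∈ N c := by
      intro u hu hua'
      by_contra huc
      exact hya' (h.edge a' ha' c hc hca'.symm (fun e => hJa' (hJ _ _ e)) u (hKB hu) y hyB
        (hK hu hyK (by rintro rfl; exact huc hyc)) hua' huc hyc)
    have hxc := key x hxK hxa'
    have hKc : ∀ u ∈ K, u ∈ N c := by
      intro u hu
      rcases hKN u hu with hua | hua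
      · by_contra huc
        exact hxa (h.edge a ha c hc hca.symm (fun e => hJ' (hJ _ _ e)) u (hKB hu) x hxB
          (hK hu hxK (by rintro rfl; exact hxa hua)) hua huc hxc)
      · exact key u hu hua
    have := h.small c hc K (fun u hu => ⟨hKc u hu, hKB hu⟩) hK
    omega

/-- Merging two twin indices preserves the covering conditions, provided the merged set still has
small cliques. -/
lemma IsCover.merge [DecidableEq ι] (h : G.IsCover w X J N B) (hJ : ∀ a b, J a b → J b a)
    (hirr : ∀ a, ¬ J a a) {a a' : ι} (ha : a ∈ X) (ha' : a' ∈ X) (hne : a ≠ a')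
    (htw : ∀ c ∈ X, c ≠ a → c ≠ a' → (J c a ↔ J c a')) {B' : Set V} (hB : B' ⊆ B)
    (hs : G.SmallCliques w ((N a ∪ N a') ∩ B')) :
    G.IsCover w (X.erase a') J (fun i => {b | b ∈ N i ∨ (i = a ∧ b ∈ N a')}) B' := by
  refine ⟨?_, ?_, ?_, ?_, ?_⟩
  · intro b hb
    obtain ⟨c, hc, hbc⟩ := h.cover b (hB hb)
    rcases eq_or_ne c a' with rfl | hca
    · exact ⟨a, by simp [ha, hne], Or.inr ⟨rfl, hbc⟩⟩
    · exact ⟨c, by simp [hc, hca], Or.inl hbc⟩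
  · intro x hx y hy hxy b hb
    have := h.disj
    have e1 := htw x (Finset.mem_of_mem_erase hx)
    have e2 := htw y (Finset.mem_of_mem_erase hy)
    simp only [Finset.mem_erase, Set.mem_ofPred_eq] at *
    grind
  · intro x hx y hy hxy hJxy b hb b' hb' hbb'
    have := h.edge
    have e1 := htw x (Finset.mem_of_mem_erase hx)
    have e2 := htw y (Finset.mem_of_mem_erase hy)
    simp only [Finset.mem_erase, Set.mem_ofPred_eq] at *
    grind
  · intro x hx y hy hxy b₁ h₁ b₂ h₂ b₃ h₃ h₁₂ h₂₃ h₁₃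
    have p := fun i hi j hj hij => h.path i hi j hj hij b₁ (hB h₁) b₂ (hB h₂) b₃ (hB h₃) h₁₂ h₂₃ h₁₃
    have e1 := htw x (Finset.mem_of_mem_erase hx)
    have e2 := htw y (Finset.mem_of_mem_erase hy)
    simp only [Finset.mem_erase, Set.mem_ofPred_eq] at *
    grind
  · intro x hx
    rcases eq_or_ne x a with rfl | hxa
    · refine hs.mono fun b hb => ⟨?_, hb.2⟩
      rcases hb.1 with h | h
      · exact Or.inl h
      · exact Or.inr h.2
    · refine (h.small x (Finset.mem_of_mem_erase hx)).mono fun b hb => ⟨?_, hB hb.2⟩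
      rcases hb.1 with h | h
      · exact h
      · exact absurd h.1 hxa

/-- Both sides of a suitable bipartition of `B` meet every maximum clique. -/
theorem IsCover.exists_bipartition (h : G.IsCover w X J N B) (hJ : ∀ a b, J a b → J b a)
    (hirr : ∀ a, ¬ J a a) (hP : P4Free J (X : Set ι)) (h1 : 1 ≤ w)
    (hw : ∀ K : Finset V, G.IsClique (K : Set V) → K.card ≤ w) :
    ∃ Y : Set V, ∀ K : Finset V, (K : Set V) ⊆ B → G.IsClique (K : Set V) → K.card = w →
      (∃ v ∈ K, v ∈ Y) ∧ ∃ v ∈ K, v ∉ Y := by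
  classical
  induction hm : X.card generalizing X N B with
  | zero =>
    refine ⟨∅, fun K hKB hK hKw => ?_⟩
    obtain ⟨v, hv⟩ := Finset.card_pos.1 (by omega : 0 < K.card)
    obtain ⟨a, ha, -⟩ := h.cover v (hKB hv)
    simp [Finset.card_eq_zero.1 hm] at ha
  | succ m ih =>
    rcases Nat.eq_zero_or_pos m with rfl | hmpos
    · obtain ⟨a, rfl⟩ := Finset.card_eq_one.1 hm
      refine ⟨∅, fun K hKB hK hKw => ?_⟩
      have := h.small a (by simp) K (fun v hv => ⟨?_, hKB hv⟩) hK
      · omega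
      · obtain ⟨c, hc, hv'⟩ := h.cover v (hKB hv)
        rwa [← Finset.mem_singleton.1 hc]
    obtain ⟨a, ha, a', ha', hne, htw⟩ := hP.exists_twins hJ (by omega)
    have hcard : (X.erase a').card = m := by rw [Finset.card_erase_of_mem ha']; omega
    have hP' : P4Free J ((X.erase a' : Finset ι) : Set ι) :=
      hP.mono (by exact_mod_cast Finset.erase_subset _ _)
    by_cases haa : J a a'
    · let Z : Set V := {v | ∃ K : Finset V, (K : Set V) ⊆ B ∧ G.IsClique (K : Set V) ∧
        K.card = w ∧ (∀ x ∈ K, x ∈ N a ∨ x ∈ N a') ∧ v ∈ K}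
      have hsm : G.SmallCliques w ((N a ∪ N a') ∩ (B \ Z)) := by
        intro K hK hKc
        by_contra hlt
        have hKw : K.card = w := le_antisymm (hw K hKc) (by omega)
        obtain ⟨v, hv⟩ := Finset.card_pos.1 (by omega : 0 < K.card)
        exact (hK hv).2.2 ⟨K, fun x hx => (hK hx).2.1, hKc, hKw, fun x hx => (hK hx).1, hv⟩
      obtain ⟨Y, hY⟩ := ih (h.merge hJ hirr ha ha' hne htw Set.sdiff_subset hsm) hP' hcard
      refine ⟨{v | (v ∈ Z ∧ v ∈ N a) ∨ (v ∉ Z ∧ v ∈ Y)}, fun K hKB hK hKw => ?_⟩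
      by_cases hKZ : ∃ y ∈ K, y ∈ Z
      · obtain ⟨y, hy, L, hLB, hL, hLw, hLN, hyL⟩ := hKZ
        have hKN : ∀ b ∈ K, b ∈ N a ∨ b ∈ N a' := by
          intro b hb
          rcases hLN y hyL with hya | hya
          · exact h.mem_union_of_twins hJ hw ha ha' haa htw hL hLw hLB hLN hK hKB hyL hy hya hb
          · exact (h.mem_union_of_twins hJ hw ha' ha (hJ _ _ haa)
              (fun c hc e1 e2 => (htw c hc e2 e1).symm) hL hLw hLB
              (fun x hx => (hLN x hx).symm) hK hKB hyL hy hya hb).symm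
        have hKZ : ∀ b ∈ K, b ∈ Z := fun b hb => ⟨K, hKB, hK, hKw, hKN, hb⟩
        have e1 : ∃ v ∈ K, v ∉ N a' := by
          by_contra! hall
          have := h.small a' ha' K (fun x hx => ⟨hall x hx, hKB hx⟩) hK
          omega
        have e2 : ∃ v ∈ K, v ∉ N a := by
          by_contra! hall
          have := h.small a ha K (fun x hx => ⟨hall x hx, hKB hx⟩) hK
          omega
        obtain ⟨v, hv, hva⟩ := e1
        obtain ⟨u, hu, hua⟩ := e2
        exact ⟨⟨v, hv, Or.inl ⟨hKZ v hv, (hKN v hv).resolve_right hva⟩⟩, u, hu, by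
          simp [hKZ u hu, hua]⟩
      · push Not at hKZ
        obtain ⟨⟨v, hv, hvY⟩, u, hu, huY⟩ := hY K (fun x hx => ⟨hKB hx, hKZ x hx⟩) hK hKw
        exact ⟨⟨v, hv, Or.inr ⟨hKZ v hv, hvY⟩⟩, u, hu, by simp [hKZ u hu, huY]⟩
    · refine ih (h.merge hJ hirr ha ha' hne htw subset_rfl ?_) hP' hcard
      intro K hK hKc
      by_contra hlt
      have e1 : ∃ v ∈ K, v ∉ N a' := by
        by_contra! hall
        have := h.small a' ha' K (fun x hx => ⟨hall x hx, (hK hx).2⟩) hKc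
        omega
      have e2 : ∃ v ∈ K, v ∉ N a := by
        by_contra! hall
        have := h.small a ha K (fun x hx => ⟨hall x hx, (hK hx).2⟩) hKc
        omega
      obtain ⟨v, hv, hva⟩ := e1
      obtain ⟨u, hu, hua⟩ := e2
      have hva' := (hK hv).1.resolve_right hva
      have hua' := (hK hu).1.resolve_left hua
      exact hua (h.edge a ha a' ha' hne haa v (hK hv).2 u (hK hu).2
        (hKc hv hu (by rintro rfl; exact hva hua')) hva' hva hua')

theorem IsCover.setColorable (h : G.IsCover w X J N B) (hJ : ∀ a b, J a b → J b a)
    (hirr : ∀ a, ¬ J a a) (hP : P4Free J (X : Set ι)) (h1 : 1 ≤ w)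
    (hw : ∀ K : Finset V, G.IsClique (K : Set V) → K.card ≤ w) {n : ℕ}
    (hn : ∀ X : Set V, G.SmallCliques w X → G.SetColorable X n) :
    G.SetColorable B (2 * n) := by
  obtain ⟨Y, hY⟩ := h.exists_bipartition hJ hirr hP h1 hw
  have e1 : G.SetColorable (B ∩ Y) n := hn _ fun K hK hKc => by
    refine (hw K hKc).lt_of_ne fun e => ?_
    obtain ⟨-, v, hv, hvY⟩ := hY K (fun x hx => (hK hx).1) hKc e
    exact hvY (hK hv).2
  have e2 : G.SetColorable (B \ Y) n := hn _ fun K hK hKc => by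
    refine (hw K hKc).lt_of_ne fun e => ?_
    obtain ⟨⟨v, hv, hvY⟩, -⟩ := hY K (fun x hx => (hK hx).1) hKc e
    exact (hK hv).2 hvY
  exact (e1.union e2).mono (Set.inter_union_sdiff B Y).ge (by omega)

end IsCover

end SimpleGraph


/-! ### Towers over a spine -/

namespace SimpleGraph

variable {V : Type*} {G : SimpleGraph V}

lemma IndPath.eq_one_of_adj {U : Set V} {l : ℕ} {x y : V} (h : G.IndPath U l x y)
    (hxy : G.Adj x y) : l = 1 := by
  obtain ⟨f, h0, h1, h2, -⟩ := h
  rcases Nat.eq_zero_or_pos l with rfl | hl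
  · exact absurd (h0.symm.trans h1) hxy.ne
  · simpa using (h2 0 l hl le_rfl).2.1 (by rwa [h0, h1])

lemma IndPath.three {a b c d : V} (hab : G.Adj a b) (hbc : G.Adj b c) (hcd : G.Adj c d)
    (hac : G.Far a c) (hbd : G.Far b d) (had : G.Far a d) : G.IndPath {b, c} 3 a d :=
  (IndPath.two hbc hcd hbd).cons hab had (by simpa using hac)

lemma IndPath.four {a b c d e : V} (hab : G.Adj a b) (hbc : G.Adj b c) (hcd : G.Adj c d)
    (hde : G.Adj d e) (hac : G.Far a c) (had : G.Far a d) (hae : G.Far a e) (hbd : G.Far b d)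
    (hbe : G.Far b e) (hce : G.Far c e) : G.IndPath {b, c, d} 4 a e :=
  (IndPath.three hbc hcd hde hbd hce hbe).cons hab hae (by simpa using ⟨hac, had⟩)

/-- A clique with a common neighbour is not maximum. -/
lemma card_lt_of_common {w : ℕ}
    (hw : ∀ K : Finset V, G.IsClique (K : Set V) → K.card ≤ w)
    {K : Finset V} (hK : G.IsClique (K : Set V)) {q : V} (hq : ∀ x ∈ K, G.Adj x q) :
    K.card < w := by
  have hqK : q ∉ K := fun e => G.irrefl (hq q e)
  by_contra hlt
  obtain ⟨z, hz, hqz⟩ := exists_not_adj_of_card_eq hw hK (le_antisymm (hw K hK) (by omega)) hqK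
  exact hqz (hq z hz).symm

/-- An induced path `s 0, …, s k` (the spine) with one vertex on each level, a connected set `F` on
level `k` touching only the last vertex of the spine, and sets `H i` on the levels `i < k`. A vertex
of `H i` adjacent to one of `s 0, …, s (k - 1)` is adjacent to `s j` exactly for
`i + α ≤ j + 1 ≤ i + β`, with `i` of parity `ε` in case `α ≠ β`, and any other vertex of `H i` has a
neighbour in `H (i - 1)`. Every vertex of `H i` has a private neighbour in `H (i + 1)` off the
neighbourhood of the spine, or a neighbour in `F` if `i + 1 = k`. -/
structure Tower (G : SimpleGraph V) where
  lev : V → ℕ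
  lev_le : ∀ x y, G.Adj x y → lev x ≤ lev y + 1
  k : ℕ
  s : ℕ → V
  lev_s : ∀ i ≤ k, lev (s i) = i
  adj_s : ∀ i < k, G.Adj (s i) (s (i + 1))
  H : ℕ → Set V
  H_zero : H 0 = ∅
  lev_H : ∀ i, ∀ x ∈ H i, lev x = i
  ne_s : ∀ i < k, ∀ x ∈ H i, x ≠ s i
  F : Set V
  lev_F : ∀ x ∈ F, lev x = k
  joined_F : ∀ x ∈ F, ∀ y ∈ F, G.Joined F x y
  not_adj_F : ∀ j < k, ∀ x ∈ F, ¬ G.Adj x (s j)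
  adj_F : ∃ x ∈ F, G.Adj x (s k)
  α : ℕ
  β : ℕ
  ε : ℕ
  α_le : α ≤ β
  β_le : β ≤ 1
  near_iff : ∀ i < k, ∀ x ∈ H i, (∃ j < k, G.Adj x (s j)) →
    ∀ j < k, (G.Adj x (s j) ↔ i + α ≤ j + 1 ∧ j + 1 ≤ i + β)
  near_parity : ∀ i < k, ∀ x ∈ H i, (∃ j < k, G.Adj x (s j)) → α ≠ β → i % 2 = ε
  parent : ∀ i, i + 1 < k → ∀ x ∈ H (i + 1), (¬ ∃ j < k, G.Adj x (s j)) → ∃ p ∈ H i, G.Adj x p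
  child : ∀ i, i + 1 < k → ∀ x ∈ H i, ∃ y ∈ H (i + 1), (¬ ∃ j < k, G.Adj y (s j)) ∧ G.Adj x y ∧
    ∀ z ∈ H i, G.Adj z y → z = x
  top : ∀ i, i + 1 = k → ∀ x ∈ H i, ∃ f ∈ F, G.Adj x f

namespace Tower

variable (T : Tower G)

/-- `x` has a neighbour among `s 0, …, s (k - 1)`. -/
def Near (x : V) : Prop := ∃ j < T.k, G.Adj x (T.s j)

/-- The first `m` vertices of the spine together with the sets `H j` for `j < i`. -/
def Low (i m : ℕ) : Set V := {x | (∃ j < m, x = T.s j) ∨ ∃ j < i, x ∈ T.H j}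

/-- The set `F` together with the vertices off the neighbourhood of the spine in the sets `H j`
for `i < j < k`. -/
def Up (i : ℕ) : Set V := {x | (∃ j, i < j ∧ j < T.k ∧ x ∈ T.H j ∧ ¬ T.Near x) ∨ x ∈ T.F}

/-- `x` and `y` are joined by an induced path of odd length whose interior lies on the spine and in
the sets `H j` for `j < i`. -/
def J (i : ℕ) (x y : V) : Prop := ∃ l, Odd l ∧ G.IndPath (T.Low i T.k) l x y

variable {T}

lemma J.symm {i : ℕ} {x y : V} (h : T.J i x y) : T.J i y x := by
  obtain ⟨l, hl, h⟩ := h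
  exact ⟨l, hl, h.symm⟩

lemma J.ne {i : ℕ} {x y : V} (h : T.J i x y) : x ≠ y := by
  obtain ⟨l, hl, h⟩ := h
  rintro rfl
  simp [h.eq_zero] at hl

lemma J_of_adj (i : ℕ) {x y : V} (h : G.Adj x y) : T.J i x y := ⟨1, odd_one, IndPath.of_adj h _⟩

variable (T)

lemma far_of_lev {x y : V} (h : T.lev x + 2 ≤ T.lev y) : G.Far x y :=
  ⟨by rintro rfl; omega, fun e => by have := T.lev_le y x e.symm; omega⟩

lemma ne_of_lev {x y : V} (h : T.lev x ≠ T.lev y) : x ≠ y := by rintro rfl; exact h rfl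

variable {T}

lemma far_s {i : ℕ} (hi : i < T.k) {x : V} (hx : x ∈ T.H i) (hn : ¬ T.Near x) {j : ℕ}
    (hj : j < T.k) : G.Far x (T.s j) := by
  refine ⟨?_, fun e => hn ⟨j, hj, e⟩⟩
  rintro rfl
  have h1 := T.lev_H i _ hx
  rw [T.lev_s j hj.le] at h1
  subst h1
  exact T.ne_s j hi _ hx rfl

lemma low_mono {i m i' m' : ℕ} (hi : i ≤ i') (hm : m ≤ m') : T.Low i m ⊆ T.Low i' m' := by
  rintro x (⟨j, hj, rfl⟩ | ⟨j, hj, hx⟩)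
  · exact Or.inl ⟨j, by omega, rfl⟩
  · exact Or.inr ⟨j, by omega, hx⟩

lemma up_anti {i i' : ℕ} (hi : i ≤ i') : T.Up i' ⊆ T.Up i := by
  rintro x (⟨j, hj, hx⟩ | hx)
  · exact Or.inl ⟨j, by omega, hx⟩
  · exact Or.inr hx

lemma lev_up {i : ℕ} (hi : i < T.k) {x : V} (hx : x ∈ T.Up i) : i < T.lev x := by
  rcases hx with ⟨j, hj, -, hx, -⟩ | hx
  · rwa [T.lev_H j x hx]
  · rwa [T.lev_F x hx]

lemma mem_up {i : ℕ} (hi : i + 1 < T.k) {x : V} (hx : x ∈ T.H (i + 1)) (hn : ¬ T.Near x) :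
    x ∈ T.Up i := Or.inl ⟨i + 1, by omega, hi, hx, hn⟩

lemma mem_low {i : ℕ} {x : V} (hx : x ∈ T.H i) (m : ℕ) : x ∈ T.Low (i + 1) m :=
  Or.inr ⟨i, by omega, hx⟩

lemma far_low_up {i : ℕ} (hi : i < T.k) {u u' : V} (hu : u ∈ T.Low i T.k) (hu' : u' ∈ T.Up i) :
    G.Far u u' := by
  rcases hu with ⟨j, hj, rfl⟩ | ⟨j, hj, hu⟩
  · rcases hu' with ⟨j', hj', hk, hu', hn⟩ | hu'
    · exact (far_s hk hu' hn hj).symm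
    · refine ⟨T.ne_of_lev ?_, fun e => T.not_adj_F j hj u' hu' e.symm⟩
      rw [T.lev_s j hj.le, T.lev_F u' hu']
      exact hj.ne
  · refine T.far_of_lev ?_
    rw [T.lev_H j u hu]
    have := lev_up hi hu'
    omega

lemma far_low {i m : ℕ} (hi : i + 1 < T.k) (hm : m ≤ T.k) {x u : V} (hx : x ∈ T.H (i + 1))
    (hn : ¬ T.Near x) (hu : u ∈ T.Low i m) : G.Far x u :=
  (far_low_up (by omega) (low_mono le_rfl hm hu) (mem_up hi hx hn)).symm

lemma pos_of_mem {i : ℕ} {x : V} (hx : x ∈ T.H i) : ∃ j, i = j + 1 := by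
  rcases i with _ | j
  · simp [T.H_zero] at hx
  · exact ⟨j, rfl⟩

/-! ### Paths above and below a level -/

lemma joined_spine (i : ℕ) {j : ℕ} (hj : j < T.k) : G.Joined (T.Low i T.k) (T.s j) (T.s 0) := by
  induction j with
  | zero => exact Joined.refl _
  | succ j ih =>
    exact (Joined.of_adj (T.adj_s j (by omega)).symm (Or.inl ⟨_, hj, rfl⟩)
      (Or.inl ⟨j, by omega, rfl⟩)).trans (ih (by omega))

lemma exists_joined_low {i : ℕ} (hi : i < T.k) {x : V} (hx : x ∈ T.H i) :
    ∃ a ∈ T.Low i T.k, G.Adj x a ∧ G.Joined (T.Low i T.k) a (T.s 0) := by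
  induction i generalizing x with
  | zero => simp [T.H_zero] at hx
  | succ i ih =>
    by_cases hn : T.Near x
    · obtain ⟨j, hj, hxj⟩ := hn
      exact ⟨_, Or.inl ⟨j, hj, rfl⟩, hxj, joined_spine _ hj⟩
    · obtain ⟨p, hp, hxp⟩ := T.parent i hi x hx hn
      obtain ⟨a, ha, hpa, haj⟩ := ih (by omega) hp
      have hs : T.Low i T.k ⊆ T.Low (i + 1) T.k := low_mono (by omega) le_rfl
      exact ⟨p, mem_low hp _, hxp, (Joined.of_adj hpa (mem_low hp _) (hs ha)).trans (haj.mono hs)⟩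

lemma exists_indPath_low {i : ℕ} (hi : i < T.k) {x y : V} (hx : x ∈ T.H i) (hy : y ∈ T.H i) :
    ∃ l, G.IndPath (T.Low i T.k) l x y := by
  obtain ⟨a, ha, hxa, haj⟩ := exists_joined_low hi hx
  obtain ⟨b, -, hyb, hbj⟩ := exists_joined_low hi hy
  exact (haj.trans hbj.symm).exists_indPath ha hxa hyb.symm

lemma exists_joined_up {i : ℕ} (hi : i < T.k) {x : V} (hx : x ∈ T.H i) :
    ∃ a ∈ T.Up i, G.Adj x a ∧ ∃ f ∈ T.F, G.Joined (T.Up i) a f := by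
  induction hm : T.k - i generalizing i x with
  | zero => omega
  | succ m ih =>
    rcases (by omega : i + 1 = T.k ∨ i + 1 < T.k) with h | h
    · obtain ⟨f, hf, hxf⟩ := T.top i h x hx
      exact ⟨f, Or.inr hf, hxf, f, hf, Joined.refl _⟩
    · obtain ⟨y, hy, hn, hxy, -⟩ := T.child i h x hx
      obtain ⟨a, ha, hya, f, hf, haf⟩ := ih h hy (by omega)
      have hs : T.Up (i + 1) ⊆ T.Up i := up_anti (by omega)
      exact ⟨y, mem_up h hy hn, hxy, f, hf,
        (Joined.of_adj hya (mem_up h hy hn) (hs ha)).trans (haf.mono hs)⟩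

lemma joined_up_F (i : ℕ) {f f' : V} (hf : f ∈ T.F) (hf' : f' ∈ T.F) : G.Joined (T.Up i) f f' :=
  (T.joined_F f hf f' hf').mono fun _ h => Or.inr h

lemma exists_indPath_up {i : ℕ} (hi : i < T.k) {x y : V} (hx : x ∈ T.H i) (hy : y ∈ T.H i) :
    ∃ l, G.IndPath (T.Up i) l x y := by
  obtain ⟨a, ha, hxa, f, hf, haf⟩ := exists_joined_up hi hx
  obtain ⟨b, -, hyb, f', hf', hbf⟩ := exists_joined_up hi hy
  exact ((haf.trans (joined_up_F i hf hf')).trans hbf.symm).exists_indPath ha hxa hyb.symm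

variable (hG : ¬ G.HasOddHole)
include hG

lemma even_add {i : ℕ} (hi : i < T.k) {x y : V} {p q : ℕ} (hxy : G.Far x y)
    (hp : G.IndPath (T.Low i T.k) p x y) (hq : G.IndPath (T.Up i) q x y) : Even (p + q) := by
  by_contra h
  exact hG (HasOddHole.of_indPaths hp hq hxy (fun u hu u' hu' => far_low_up hi hu hu')
    (Nat.not_even_iff_odd.1 h))

/-- All induced paths through `Low i k` between two given vertices of `H i` have the same parity,
since they close up through `Up i`. -/
lemma J_iff {i : ℕ} (hi : i < T.k) {x y : V} (hx : x ∈ T.H i) (hy : y ∈ T.H i) {l : ℕ}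
    (hl : G.IndPath (T.Low i T.k) l x y) : T.J i x y ↔ Odd l := by
  refine ⟨?_, fun h => ⟨l, h, hl⟩⟩
  rintro ⟨l', h', hl'⟩
  by_cases hxy : x = y
  · subst hxy
    simp [hl'.eq_zero] at h'
  by_cases hadj : G.Adj x y
  · simp [hl.eq_one_of_adj hadj]
  · obtain ⟨q, hq⟩ := exists_indPath_up hi hx hy
    have e1 := even_add hG hi ⟨hxy, hadj⟩ hl hq
    have e2 := even_add hG hi ⟨hxy, hadj⟩ hl' hq
    rw [Nat.even_add'] at e1 e2
    exact e1.2 (e2.1 h')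

lemma not_J_of_common {i : ℕ} (hi : i < T.k) {x y q : V} (hx : x ∈ T.H i) (hy : y ∈ T.H i)
    (hxy : ¬ G.Adj x y) (hq : q ∈ T.Low i T.k) (hxq : G.Adj x q) (hyq : G.Adj y q) :
    ¬ T.J i x y := by
  intro h
  have := (J_iff hG hi hx hy ((IndPath.two hxq hyq.symm ⟨h.ne, hxy⟩).mono (by simpa using hq))).1 h
  exact absurd this (by decide)

/-- Passing from two vertices to nonadjacent children of theirs preserves `J`, if each child is
attached to only one of the two. -/
lemma J_parent_iff {i : ℕ} (hi : i + 1 < T.k) {x y p q : V} (hx : x ∈ T.H (i + 1))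
    (hy : y ∈ T.H (i + 1)) (hnx : ¬ T.Near x) (hny : ¬ T.Near y) (hxy : G.Far x y)
    (hp : p ∈ T.H i) (hq : q ∈ T.H i) (hxp : G.Adj x p) (hyq : G.Adj y q) (hxq : ¬ G.Adj x q)
    (hyp : ¬ G.Adj y p) : T.J i p q ↔ T.J (i + 1) x y := by
  have far : ∀ u ∈ T.H (i + 1), ∀ v ∈ T.H i, ¬ G.Adj u v → G.Far u v := fun u hu v hv h =>
    ⟨T.ne_of_lev (by rw [T.lev_H _ _ hu, T.lev_H _ _ hv]; omega), h⟩
  obtain ⟨l, hl⟩ := exists_indPath_low (by omega) hp hq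
  have h1 := hl.cons hxp (far x hx q hq hxq) fun u hu => far_low hi le_rfl hx hnx hu
  have h2 := h1.snoc hyq.symm hxy (by
    rintro u (rfl | hu)
    · exact (far y hy u hp hyp).symm
    · exact (far_low hi le_rfl hy hny hu).symm)
  have h3 : G.IndPath (T.Low (i + 1) T.k) (l + 1 + 1) x y := h2.mono (by
    rintro u (rfl | rfl | hu)
    · exact mem_low hq _
    · exact mem_low hp _
    · exact low_mono (by omega) le_rfl hu)
  rw [J_iff hG (by omega) hp hq hl, J_iff hG hi hx hy h3]
  simp [parity_simps]

omit hG

/-! ### Paths to the spine -/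

lemma indPath_spine {a b : ℕ} (hab : a ≤ b) (hb : b ≤ T.k) :
    G.IndPath {x | ∃ j, a < j ∧ j < b ∧ x = T.s j} (b - a) (T.s a) (T.s b) := by
  refine ⟨fun t => T.s (a + t), rfl, by simp only; congr 1; omega, fun i j hij hj => ⟨?_, ?_⟩,
    fun i hi hi' => ⟨a + i, by omega, by omega, rfl⟩⟩
  · refine T.ne_of_lev ?_
    rw [T.lev_s _ (by omega), T.lev_s _ (by omega)]
    omega
  · constructor
    · intro h
      have := T.lev_le _ _ h.symm
      rw [T.lev_s _ (by omega), T.lev_s _ (by omega)] at this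
      omega
    · rintro rfl
      exact T.adj_s _ (by omega)

lemma far_s_k {i : ℕ} (hi : i + 2 ≤ T.k) {x : V} (hx : x ∈ T.H i) : G.Far x (T.s T.k) :=
  T.far_of_lev (by rw [T.lev_H i x hx, T.lev_s _ le_rfl]; omega)

lemma Near.adj {i : ℕ} (hi : i < T.k) {x : V} (hx : x ∈ T.H i) (hn : T.Near x) :
    G.Adj x (T.s (i + T.β - 1)) := by
  obtain ⟨j, rfl⟩ := pos_of_mem hx
  have := T.α_le
  have := T.β_le
  exact (T.near_iff _ hi x hx hn _ (by omega)).2 (by omega)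

lemma Near.indPath {i m : ℕ} (hi : i < T.k) {x : V} (hx : x ∈ T.H i) (hn : T.Near x)
    (hm : i + T.β ≤ m + 1) (hmk : m ≤ T.k) (h : i + 2 ≤ T.k ∨ m < T.k) :
    ∃ l, l % 2 = (m + i + T.β) % 2 ∧ G.IndPath (T.Low 0 m) l x (T.s m) := by
  obtain ⟨j, rfl⟩ := pos_of_mem hx
  have hadj := hn.adj hi hx
  have hβ := T.β_le
  have far : ∀ t, j + T.β < t → t < T.k → G.Far x (T.s t) := fun t ht htk => by
    refine ⟨?_, fun e => ?_⟩
    · rintro rfl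
      have := T.lev_H _ _ hx
      rw [T.lev_s _ htk.le] at this
      subst this
      exact T.ne_s _ hi _ hx rfl
    · have := (T.near_iff _ hi x hx hn _ htk).1 e
      omega
  rcases (by omega : m = j + T.β ∨ j + T.β < m) with rfl | hlt
  · refine ⟨1, by omega, ?_⟩
    have e : j + 1 + T.β - 1 = j + T.β := by omega
    rw [e] at hadj
    exact IndPath.of_adj hadj _
  · have e : j + 1 + T.β - 1 = j + T.β := by omega
    rw [e] at hadj
    have hfar : G.Far x (T.s m) := by
      rcases hmk.lt_or_eq with hlt' | rfl
      · exact far m hlt hlt'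
      · exact far_s_k (by omega) hx
    have := (indPath_spine hlt.le hmk).cons hadj hfar (by
      rintro u ⟨t, ht, htm, rfl⟩
      exact far t ht (by omega))
    refine ⟨_, ?_, this.mono ?_⟩
    · omega
    · rintro u (rfl | ⟨t, -, ht, rfl⟩)
      · exact Or.inl ⟨_, hlt, rfl⟩
      · exact Or.inl ⟨t, ht, rfl⟩

/-- A descent from `x ∈ H i` to the spine, continued up the spine to `s m`. Its parity depends on
`i`, `m` and the type of the tower only. -/
lemma exists_indPath_down {i m : ℕ} (hi : i < T.k) {x : V} (hx : x ∈ T.H i)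
    (hm : i + T.β ≤ m + 1) (hmk : m ≤ T.k) (h : i + 2 ≤ T.k ∨ m < T.k) :
    ∃ l, l % 2 = (m + i + T.β) % 2 ∧ G.IndPath (T.Low i m) l x (T.s m) := by
  induction i generalizing x with
  | zero => simp [T.H_zero] at hx
  | succ i ih =>
    by_cases hn : T.Near x
    · obtain ⟨l, hl, hp⟩ := hn.indPath hi hx hm hmk h
      exact ⟨l, hl, hp.mono (low_mono (by omega) le_rfl)⟩
    · obtain ⟨p, hp, hxp⟩ := T.parent i hi x hx hn
      obtain ⟨l, hl, hpath⟩ := ih (by omega) hp (by omega) (by omega)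
      have hfar : G.Far x (T.s m) := by
        rcases hmk.lt_or_eq with hlt' | rfl
        · exact far_s hi hx hn hlt'
        · exact far_s_k (by omega) hx
      have := hpath.cons hxp hfar fun u hu => far_low hi hmk hx hn hu
      refine ⟨l + 1, by omega, this.mono ?_⟩
      rintro u (rfl | hu)
      · exact mem_low hp _
      · exact low_mono (by omega) le_rfl hu

/-! ### Adjacent vertices on a common level -/

lemma far_child {i : ℕ} (hi : i + 2 ≤ T.k) {v x u : V} (hx : x ∈ T.H (i + 1)) (hn : ¬ T.Near x)
    (hpriv : ∀ z ∈ T.H i, G.Adj z x → z = v) (hu : u ∈ T.Low i T.k ∨ (u ∈ T.H i ∧ u ≠ v)) :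
    G.Far u x := by
  rcases hu with hu | ⟨hu, huv⟩
  · exact far_low_up (by omega) hu (mem_up (by omega) hx hn)
  · refine ⟨T.ne_of_lev ?_, fun e => huv (hpriv u hu e)⟩
    rw [T.lev_H _ _ hu, T.lev_H _ _ hx]
    omega

lemma far_up_succ {i : ℕ} (hi : i + 2 ≤ T.k) {u u' : V} (hu : u ∈ T.Low i T.k ∨ u ∈ T.H i)
    (hu' : u' ∈ T.Up (i + 1)) : G.Far u u' := by
  rcases hu with hu | hu
  · exact far_low_up (by omega) hu (up_anti (by omega) hu')
  · refine T.far_of_lev ?_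
    rw [T.lev_H _ _ hu]
    exact lev_up (by omega) hu'

include hG

/-- Induced paths from `v ∈ H i` to the end of the spine that stay on the levels up to `i` have the
same parity: both close up through a private child of `v`. -/
lemma parity_eq_to_spine {i : ℕ} (hi : i + 2 ≤ T.k) {v : V} (hv : v ∈ T.H i) {U : Set V}
    (hU : ∀ u ∈ U, u ∈ T.Low i T.k ∨ (u ∈ T.H i ∧ u ≠ v)) {p q : ℕ}
    (hp : G.IndPath U p v (T.s T.k)) (hq : G.IndPath U q v (T.s T.k)) : p % 2 = q % 2 := by
  obtain ⟨x, hx, hn, hvx, hpriv⟩ := T.child i (by omega) v hv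
  obtain ⟨a, ha, hxa, f, hf, haf⟩ := exists_joined_up (i := i + 1) (by omega) hx
  obtain ⟨f', hf', hfd⟩ := T.adj_F
  have hs : T.Up (i + 1) ⊆ insert x (T.Up (i + 1)) := Set.subset_insert _ _
  have hj : G.Joined (insert x (T.Up (i + 1))) x f' :=
    (Joined.of_adj hxa (by simp) (hs ha)).trans ((haf.trans (joined_up_F _ hf hf')).mono hs)
  obtain ⟨l, hl⟩ := hj.exists_indPath (by simp) hvx hfd
  have key : ∀ p, G.IndPath U p v (T.s T.k) → ¬ Odd (p + l) := by
    intro p hp hodd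
    refine hG (HasOddHole.of_indPaths hp hl (far_s_k hi hv) ?_ hodd)
    rintro u hu u' (rfl | hu')
    · exact far_child hi hx hn hpriv (hU u hu)
    · exact far_up_succ hi ((hU u hu).imp_right And.left) hu'
  have h1 := key p hp
  have h2 := key q hq
  rw [Nat.odd_iff] at h1 h2
  omega

/-- The same for induced paths between two nonadjacent vertices of `H i`. -/
lemma parity_eq_of_far {i : ℕ} (hi : i + 2 ≤ T.k) {v w : V} (hv : v ∈ T.H i) (hw : w ∈ T.H i)
    (hvw : G.Far v w) {U : Set V}
    (hU : ∀ u ∈ U, u ∈ T.Low i T.k ∨ (u ∈ T.H i ∧ u ≠ v ∧ u ≠ w)) {p q : ℕ}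
    (hp : G.IndPath U p v w) (hq : G.IndPath U q v w) : p % 2 = q % 2 := by
  obtain ⟨x, hx, hn, hvx, hpriv⟩ := T.child i (by omega) v hv
  obtain ⟨y, hy, hm, hwy, hpriv'⟩ := T.child i (by omega) w hw
  obtain ⟨a, ha, hxa, f, hf, haf⟩ := exists_joined_up (i := i + 1) (by omega) hx
  obtain ⟨b, hb, hyb, f', hf', hbf⟩ := exists_joined_up (i := i + 1) (by omega) hy
  have hs : T.Up (i + 1) ⊆ insert x (insert y (T.Up (i + 1))) :=
    (Set.subset_insert _ _).trans (Set.subset_insert _ _)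
  have hj : G.Joined (insert x (insert y (T.Up (i + 1)))) x y :=
    ((Joined.of_adj hxa (by simp) (hs ha)).trans
      (((haf.trans (joined_up_F _ hf hf')).trans hbf.symm).mono hs)).trans
      (Joined.of_adj hyb.symm (hs hb) (by simp))
  obtain ⟨l, hl⟩ := hj.exists_indPath (by simp) hvx hwy.symm
  have key : ∀ p, G.IndPath U p v w → ¬ Odd (p + l) := by
    intro p hp hodd
    refine hG (HasOddHole.of_indPaths hp hl hvw ?_ hodd)
    rintro u hu u' (rfl | rfl | hu')
    · exact far_child hi hx hn hpriv ((hU u hu).imp_right fun h => ⟨h.1, h.2.1⟩)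
    · exact far_child hi hy hm hpriv' ((hU u hu).imp_right fun h => ⟨h.1, h.2.2⟩)
    · exact far_up_succ hi ((hU u hu).imp_right And.left) hu'
  have h1 := key p hp
  have h2 := key q hq
  rw [Nat.odd_iff] at h1 h2
  omega

omit hG

variable (T) in
/-- `u` and `v` are attached in the same way to the levels below: both to the spine, or else to the
same vertices of the previous level. -/
def Sib (i : ℕ) (u v : V) : Prop :=
  (T.Near u ∧ T.Near v) ∨
    (¬ T.Near u ∧ ¬ T.Near v ∧ ∀ j, j + 1 = i → ∀ w ∈ T.H j, (G.Adj u w ↔ G.Adj v w))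

lemma Sib.trans {i : ℕ} {u v w : V} (h : T.Sib i u v) (h' : T.Sib i v w) : T.Sib i u w := by
  rcases h with h | h <;> rcases h' with h' | h'
  · exact Or.inl ⟨h.1, h'.2⟩
  · exact absurd h.2 h'.1
  · exact absurd h'.1 h.2.1
  · exact Or.inr ⟨h.1, h'.2.1, fun j hj w hw => (h.2.2 j hj w hw).trans (h'.2.2 j hj w hw)⟩

lemma exists_common {i : ℕ} (hi : i < T.k) {a : V} (ha : a ∈ T.H i) :
    ∃ q ∈ T.Low i T.k, G.Adj a q ∧ ∀ b ∈ T.H i, T.Sib i a b → G.Adj b q := by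
  obtain ⟨j, rfl⟩ := pos_of_mem ha
  by_cases hn : T.Near a
  · refine ⟨T.s (j + 1 + T.β - 1), Or.inl ⟨_, ?_, rfl⟩, hn.adj hi ha, fun b hb hab => ?_⟩
    · have := T.β_le
      omega
    · rcases hab with h | h
      · exact h.2.adj hi hb
      · exact absurd hn h.1
  · obtain ⟨p, hp, hap⟩ := T.parent j hi a ha hn
    refine ⟨p, mem_low hp _, hap, fun b hb hab => ?_⟩
    rcases hab with h | h
    · exact absurd h.1 hn
    · exact (h.2.2 j rfl p hp).1 hap

include hG

/-- Otherwise the descent of `v`, and the one that first steps from `v` to `u`, differ in parity. -/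
lemma not_adj_near_of_not_near {i : ℕ} (hi : i + 2 ≤ T.k) {u v : V} (hu : u ∈ T.H i)
    (hv : v ∈ T.H i) (hnu : T.Near u) (hnv : ¬ T.Near v) : ¬ G.Adj u v := by
  intro huv
  have hβ := T.β_le
  obtain ⟨l₁, h₁, p₁⟩ := exists_indPath_down (m := T.k) (by omega) hv (by omega) le_rfl (by omega)
  obtain ⟨l₂, h₂, p₂⟩ := hnu.indPath (m := T.k) (by omega) hu (by omega) le_rfl (by omega)
  have p₃ := p₂.cons huv.symm (far_s_k hi hv) (by
    rintro w (⟨j, hj, rfl⟩ | ⟨j, hj, -⟩)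
    · exact far_s (by omega) hv hnv hj
    · omega)
  have := parity_eq_to_spine hG hi hv (U := insert u (T.Low i T.k)) (by
    rintro w (rfl | hw)
    · exact Or.inr ⟨hu, huv.ne⟩
    · exact Or.inl hw) (p₁.mono (Set.subset_insert _ _))
    (p₃.mono (Set.insert_subset_insert (low_mono (by omega) le_rfl)))
  omega

lemma adj_parent_of_adj {i : ℕ} (hi : i + 3 ≤ T.k) {u v w : V} (hu : u ∈ T.H (i + 1))
    (hv : v ∈ T.H (i + 1)) (hnu : ¬ T.Near u) (hnv : ¬ T.Near v) (huv : G.Adj u v)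
    (hw : w ∈ T.H i) (huw : G.Adj u w) : G.Adj v w := by
  by_contra hvw
  have hβ := T.β_le
  obtain ⟨l₁, h₁, p₁⟩ := exists_indPath_down (m := T.k) (by omega) hv (by omega) le_rfl (by omega)
  obtain ⟨l₂, h₂, p₂⟩ := exists_indPath_down (m := T.k) (by omega) hw (by omega) le_rfl (by omega)
  have p₃ := p₂.cons huw (far_s_k (by omega) hu) fun x hx => far_low (by omega) le_rfl hu hnu hx
  have p₄ := p₃.cons huv.symm (far_s_k (by omega) hv) (by
    rintro x (rfl | hx)
    · exact ⟨T.ne_of_lev (by rw [T.lev_H _ _ hv, T.lev_H _ _ hw]; omega), hvw⟩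
    · exact far_low (by omega) le_rfl hv hnv hx)
  have := parity_eq_to_spine hG (by omega) hv (U := insert u (T.Low (i + 1) T.k)) (by
    rintro w (rfl | hw)
    · exact Or.inr ⟨hu, huv.ne⟩
    · exact Or.inl hw) (p₁.mono (Set.subset_insert _ _))
    (p₄.mono (Set.insert_subset_insert (by
      rintro x (rfl | hx)
      · exact mem_low hw _
      · exact low_mono (by omega) le_rfl hx)))
  omega

lemma sib_of_adj {i : ℕ} (hi : i + 2 ≤ T.k) {u v : V} (hu : u ∈ T.H i) (hv : v ∈ T.H i)
    (huv : G.Adj u v) : T.Sib i u v := by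
  by_cases hnu : T.Near u <;> by_cases hnv : T.Near v
  · exact Or.inl ⟨hnu, hnv⟩
  · exact absurd huv (not_adj_near_of_not_near hG hi hu hv hnu hnv)
  · exact absurd huv.symm (not_adj_near_of_not_near hG hi hv hu hnv hnu)
  · refine Or.inr ⟨hnu, hnv, ?_⟩
    rintro j rfl w hw
    exact ⟨adj_parent_of_adj hG (by omega) hu hv hnu hnv huv hw,
      adj_parent_of_adj hG (by omega) hv hu hnv hnu huv.symm hw⟩

/-- An induced path on four vertices of `H i` has ends with a common neighbour further down, hence
joined by induced paths of lengths two and three. -/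
lemma p4Free_adj {i : ℕ} (hi : i + 2 ≤ T.k) : P4Free G.Adj (T.H i) := by
  intro a ha b hb c hc d hd hab hbc hcd hac hbd had
  have sab := sib_of_adj hG hi ha hb hab
  have sac := sab.trans (sib_of_adj hG hi hb hc hbc)
  have sad := sac.trans (sib_of_adj hG hi hc hd hcd)
  obtain ⟨q, hq, haq, hq'⟩ := exists_common (by omega) ha
  have fac : G.Far a c := ⟨by rintro rfl; exact had hcd, hac⟩
  have fbd : G.Far b d := ⟨by rintro rfl; exact had hab, hbd⟩
  have fad : G.Far a d := ⟨by rintro rfl; exact hac hcd.symm, had⟩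
  have p₂ := IndPath.two haq (hq' d hd sad).symm fad
  have p₃ := IndPath.three hab hbc hcd fac fbd fad
  have := parity_eq_of_far hG hi ha hd fad (U := {q, b, c}) (by
    rintro u (rfl | rfl | rfl)
    · exact Or.inl hq
    · exact Or.inr ⟨hb, hab.ne', fbd.1⟩
    · exact Or.inr ⟨hc, fac.1.symm, hcd.ne⟩) (p₂.mono (by simp))
    (p₃.mono (Set.subset_insert _ _))
  omega

lemma smallCliques_H {w : ℕ} (hw : ∀ K : Finset V, G.IsClique (K : Set V) → K.card ≤ w)
    (h1 : 1 ≤ w) {i : ℕ} (hi : i + 2 ≤ T.k) : G.SmallCliques w (T.H i) := by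
  intro K hKH hK
  rcases K.eq_empty_or_nonempty with rfl | ⟨a, ha⟩
  · rw [Finset.card_empty]
    omega
  obtain ⟨q, -, haq, hq⟩ := exists_common (by omega) (hKH ha)
  refine card_lt_of_common hw hK (q := q) fun x hx => ?_
  by_cases hax : a = x
  · exact hax ▸ haq
  · exact hq x (hKH hx) (sib_of_adj hG hi (hKH ha) (hKH hx) (hK ha hx hax))

lemma setColorable_H [Finite V] {w : ℕ}
    (hw : ∀ K : Finset V, G.IsClique (K : Set V) → K.card ≤ w) (h1 : 1 ≤ w) {i : ℕ}
    (hi : i + 2 ≤ T.k) : G.SetColorable (T.H i) (w - 1) := by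
  have hfin : (T.H i).Finite := Set.toFinite _
  obtain ⟨K, hK, hKc, hKq⟩ := exists_isClique_setColorable_of_p4Free (X := hfin.toFinset)
    (by simpa using p4Free_adj hG hi)
  have := smallCliques_H hG hw h1 hi K (by simpa using hK) hKc
  exact hKq.mono (by simp) (by omega)

/-! ### The relation `J` has no induced path on four vertices -/

/-- Between a neighbour and a non-neighbour of the spine, `J` depends on the type of the tower
only. -/
lemma J_near_iff {i : ℕ} (hi : i + 2 ≤ T.k) {u v : V} (hu : u ∈ T.H i) (hv : v ∈ T.H i)
    (hnu : T.Near u) (hnv : ¬ T.Near v) : T.J i u v ↔ T.α ≠ T.β := by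
  obtain ⟨i, rfl⟩ := pos_of_mem hu
  have hαβ := T.α_le
  have hβ := T.β_le
  have hadj := not_adj_near_of_not_near hG hi hu hv hnu hnv
  have huv : G.Far u v := ⟨by rintro rfl; contradiction, hadj⟩
  have hiff := T.near_iff _ (by omega) u hu hnu
  have hsu : ∀ j < T.k, u ≠ T.s j := fun j hj e => by
    have h1 := T.lev_H _ _ hu
    rw [e, T.lev_s j hj.le] at h1
    subst h1
    exact T.ne_s _ (by omega) _ hu e
  have hlow : ∀ m ≤ i + T.α, ∀ x ∈ T.Low i m, G.Far x u := by
    rintro m hm x (⟨j, hj, rfl⟩ | ⟨j, hj, hx⟩)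
    · refine ⟨(hsu j (by omega)).symm, fun e => ?_⟩
      have := (hiff j (by omega)).1 e.symm
      omega
    · refine T.far_of_lev ?_
      rw [T.lev_H _ _ hx, T.lev_H _ _ hu]
      omega
  -- the parity of a path from `v` through a parent `q` of `v`, along the spine, and to `u`
  obtain ⟨q, hq, hvq⟩ := T.parent i (by omega) v hv hnv
  have hqu : q ≠ u := T.ne_of_lev (by rw [T.lev_H _ _ hq, T.lev_H _ _ hu]; omega)
  by_cases huq : G.Adj u q
  · refine iff_of_false (not_J_of_common hG (by omega) hu hv hadj (mem_low hq _) huq hvq) ?_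
    intro hne
    have hnq : ¬ T.Near q := fun hnq => by
      have h1 := T.near_parity _ (by omega) q hq hnq hne
      have h2 := T.near_parity _ (by omega) u hu hnu hne
      omega
    obtain ⟨l, hl, p⟩ := exists_indPath_down (m := i) (by omega) hq (by omega) (by omega)
      (by omega)
    have hsi : G.Adj u (T.s i) := (hiff i (by omega)).2 (by omega)
    have hfar := far_s (by omega) hq hnq (j := i) (by omega)
    refine hG (HasOddHole.of_indPaths p (IndPath.two huq.symm hsi hfar) hfar ?_ ?_)
    · rintro x hx y rfl
      exact hlow i (by omega) x hx
    · rw [Nat.odd_iff]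
      omega
  · obtain ⟨l, hl, p⟩ := exists_indPath_down (m := i + T.α) (by omega) hq (by omega) (by omega)
      (by omega)
    have p₁ := p.cons hvq (far_s (by omega) hv hnv (by omega)) fun x hx =>
      far_low (by omega) (by omega) hv hnv hx
    have p₂ := p₁.snoc ((hiff _ (by omega)).2 (by omega)).symm huv.symm (by
      rintro x (rfl | hx)
      · exact ⟨hqu, fun e => huq e.symm⟩
      · exact hlow _ le_rfl x hx)
    rw [J_iff hG (by omega) hu hv (p₂.symm.mono (by
      rintro x (rfl | rfl | hx)
      · exact Or.inl ⟨_, by omega, rfl⟩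
      · exact mem_low hq _
      · exact low_mono (by omega) (by omega) hx)), Nat.odd_iff]
    omega

/-- `J` inherits the absence of induced four-vertex paths from the previous level. -/
lemma p4Free_J_step {i : ℕ} (hi : i + 1 < T.k) (ih : P4Free (T.J i) (T.H i)) {X : Set V}
    (hX : X ⊆ T.H (i + 1)) (hn : ∀ x ∈ X, ¬ T.Near x)
    (hpar : ∀ x ∈ X, ∀ y ∈ X, G.Adj x y → ∀ w ∈ T.H i, G.Adj x w → G.Adj y w)
    (hadj : P4Free G.Adj X) : P4Free (T.J (i + 1)) X := by
  intro a ha b hb c hc d hd hab hbc hcd hac hbd had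
  have nac : G.Far a c := ⟨by rintro rfl; exact had hcd, fun e => hac (J_of_adj _ e)⟩
  have nbd : G.Far b d := ⟨by rintro rfl; exact had hab, fun e => hbd (J_of_adj _ e)⟩
  have nad : G.Far a d := ⟨by rintro rfl; exact hac hcd.symm, fun e => had (J_of_adj _ e)⟩
  have share : ∀ x ∈ X, ∀ y ∈ X, T.J (i + 1) x y → ¬ G.Adj x y → ∀ p ∈ T.H i, G.Adj x p →
      ¬ G.Adj y p := fun x hx y hy hJ hxy p hp hxp hyp =>
    not_J_of_common hG hi (hX hx) (hX hy) hxy (mem_low hp _) hxp hyp hJ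
  have par : ∀ x ∈ X, ∃ p ∈ T.H i, G.Adj x p := fun x hx => T.parent i hi x (hX hx) (hn x hx)
  have F2 : ∀ x ∈ X, ∀ y ∈ X, G.Far x y → ∀ p ∈ T.H i, ∀ q ∈ T.H i, G.Adj x p → G.Adj y q →
      ¬ G.Adj x q → ¬ G.Adj y p → (T.J i p q ↔ T.J (i + 1) x y) :=
    fun x hx y hy hxy p hp q hq => J_parent_iff hG hi (hX hx) (hX hy) (hn x hx) (hn y hy) hxy hp hq
  -- `z` relates equally to two adjacent vertices, if it is adjacent to neither
  have R : ∀ x ∈ X, ∀ y ∈ X, ∀ z ∈ X, G.Adj x y → G.Far z x → G.Far z y → T.J (i + 1) z x →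
      T.J (i + 1) z y := by
    intro x hx y hy z hz hxy hzx hzy hJ
    obtain ⟨p, hp, hxp⟩ := par x hx
    obtain ⟨q, hq, hzq⟩ := par z hz
    have hxq := share z hz x hx hJ hzx.2 q hq hzq
    have hzp := fun e => share z hz x hx hJ hzx.2 p hp e hxp
    have hyp := hpar x hx y hy hxy p hp hxp
    have hyq := fun e => hxq (hpar y hy x hx hxy.symm q hq e)
    exact (F2 z hz y hy hzy q hq p hp hzq hyp hzp hyq).1
      ((F2 z hz x hx hzx q hq p hp hzq hxp hzp hxq).2 hJ)
  by_cases jbc : G.Adj b c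
  · by_cases jab : G.Adj a b
    · by_cases jcd : G.Adj c d
      · exact hadj a ha b hb c hc d hd jab jbc jcd nac.2 nbd.2 nad.2
      · exact hbd (R c hc b hb d hd jbc.symm (Far.symm ⟨hcd.ne, jcd⟩) nbd.symm hcd.symm).symm
    · exact hac (R b hb c hc a ha jbc ⟨hab.ne, jab⟩ nac hab)
  have nbc : G.Far b c := ⟨hbc.ne, jbc⟩
  by_cases jab : G.Adj a b
  · exact hac (R b hb a ha c hc jab.symm nbc.symm nac.symm hbc.symm).symm
  by_cases jcd : G.Adj c d
  · exact hbd (R c hc d hd b hb jcd nbc nbd hbc)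
  have nab : G.Far a b := ⟨hab.ne, jab⟩
  have ncd : G.Far c d := ⟨hcd.ne, jcd⟩
  have sab := share a ha b hb hab jab
  have sbc := share b hb c hc hbc jbc
  have scd := share c hc d hd hcd jcd
  obtain ⟨pa, hpa, ea⟩ := par a ha
  obtain ⟨pb, hpb, eb⟩ := par b hb
  obtain ⟨pc, hpc, ec⟩ := par c hc
  obtain ⟨pd, hpd, ed⟩ := par d hd
  by_cases sad : ∃ p ∈ T.H i, G.Adj a p ∧ G.Adj d p
  · obtain ⟨p, hp, hap, hdp⟩ := sad
    have sbd : ∃ r ∈ T.H i, G.Adj b r ∧ G.Adj d r := by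
      by_contra! hcon
      have h1 := F2 b hb a ha nab.symm pb hpb p hp eb hap (sab p hp hap) fun e => sab pb hpb e eb
      have h2 := F2 b hb d hd nbd pb hpb p hp eb hdp (sab p hp hap) (hcon pb hpb eb)
      exact hbd (h2.1 (h1.2 hab.symm))
    have sac : ∃ q ∈ T.H i, G.Adj a q ∧ G.Adj c q := by
      by_contra! hcon
      have h1 := F2 c hc d hd ncd pc hpc p hp ec hdp (fun e => scd p hp e hdp) (scd pc hpc ec)
      have h2 := F2 c hc a ha nac.symm pc hpc p hp ec hap (fun e => scd p hp e hdp)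
        (fun e => hcon pc hpc e ec)
      exact hac (h2.1 (h1.2 hcd)).symm
    obtain ⟨r, hr, hbr, hdr⟩ := sbd
    obtain ⟨q, hq, haq, hcq⟩ := sac
    have h1 := F2 b hb c hc nbc r hr q hq hbr hcq (sab q hq haq) (sbc r hr hbr)
    have h2 := F2 d hd a ha nad.symm r hr q hq hdr haq (scd q hq hcq) fun e => sab r hr e hbr
    exact had (h2.1 (h1.2 hbc)).symm
  push Not at sad
  by_cases sac : ∃ p ∈ T.H i, G.Adj a p ∧ G.Adj c p
  · obtain ⟨p, hp, hap, hcp⟩ := sac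
    have h1 := F2 c hc d hd ncd p hp pd hpd hcp ed (fun e => scd pd hpd e ed) (scd p hp hcp)
    have h2 := F2 a ha d hd nad p hp pd hpd hap ed (fun e => sad pd hpd e ed) (scd p hp hcp)
    exact had (h2.1 (h1.2 hcd))
  push Not at sac
  by_cases sbd : ∃ p ∈ T.H i, G.Adj b p ∧ G.Adj d p
  · obtain ⟨p, hp, hbp, hdp⟩ := sbd
    have h1 := F2 a ha b hb nab pa hpa p hp ea hbp (fun e => sab p hp e hbp) (sab pa hpa ea)
    have h2 := F2 a ha d hd nad pa hpa p hp ea hdp (fun e => sab p hp e hbp) (sad pa hpa ea)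
    exact had (h2.1 (h1.2 hab))
  push Not at sbd
  have t : ∀ x ∈ X, ∀ y ∈ X, G.Far x y → ∀ p ∈ T.H i, ∀ q ∈ T.H i, G.Adj x p → G.Adj y q →
      (∀ p ∈ T.H i, G.Adj x p → ¬ G.Adj y p) → (T.J i p q ↔ T.J (i + 1) x y) :=
    fun x hx y hy hxy p hp q hq h1 h2 h3 =>
      F2 x hx y hy hxy p hp q hq h1 h2 (fun e => h3 q hq e h2) (h3 p hp h1)
  refine ih pa hpa pb hpb pc hpc pd hpd ?_ ?_ ?_ ?_ ?_ ?_
  · rwa [t a ha b hb nab pa hpa pb hpb ea eb sab]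
  · rwa [t b hb c hc nbc pb hpb pc hpc eb ec sbc]
  · rwa [t c hc d hd ncd pc hpc pd hpd ec ed scd]
  · rwa [t a ha c hc nac pa hpa pc hpc ea ec sac]
  · rwa [t b hb d hd nbd pb hpb pd hpd eb ed sbd]
  · rwa [t a ha d hd nad pa hpa pd hpd ea ed sad]

theorem p4Free_J {i : ℕ} (hi : i + 2 ≤ T.k) : P4Free (T.J i) (T.H i) := by
  induction i with
  | zero => simp [T.H_zero, P4Free]
  | succ i ih =>
    have hstep : P4Free (T.J (i + 1)) {x ∈ T.H (i + 1) | ¬ T.Near x} := by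
      refine p4Free_J_step hG (by omega) (ih (by omega)) (fun x hx => hx.1) (fun x hx => hx.2) ?_
        ((p4Free_adj hG hi).mono fun x hx => hx.1)
      intro x hx y hy hxy w hw hxw
      exact adj_parent_of_adj hG (by omega) hx.1 hy.1 hx.2 hy.2 hxy hw hxw
    have hnear : ∀ x ∈ T.H (i + 1), ∀ y ∈ T.H (i + 1), T.Near x → T.Near y →
        T.J (i + 1) x y → G.Adj x y := by
      intro x hx y hy hnx hny hJ
      by_contra hxy
      have := T.β_le
      exact not_J_of_common hG (by omega) hx hy hxy (Or.inl ⟨_, by omega, rfl⟩)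
        (hnx.adj (by omega) hx) (hny.adj (by omega) hy) hJ
    have hmix : ∀ x ∈ T.H (i + 1), ∀ y ∈ T.H (i + 1), T.Near x → ¬ T.Near y →
        (T.J (i + 1) x y ↔ T.α ≠ T.β) := fun x hx y hy => J_near_iff hG hi hx hy
    have hmix' : ∀ x ∈ T.H (i + 1), ∀ y ∈ T.H (i + 1), ¬ T.Near x → T.Near y →
        (T.J (i + 1) x y ↔ T.α ≠ T.β) := fun x hx y hy hnx hny =>
      ⟨fun h => (hmix y hy x hx hny hnx).1 h.symm, fun h => ((hmix y hy x hx hny hnx).2 h).symm⟩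
    intro a ha b hb c hc d hd hab hbc hcd hac hbd had
    -- four elements among which `J` is a path cannot be split homogeneously
    have hall : (T.Near a ↔ T.Near b) ∧ (T.Near a ↔ T.Near c) ∧ (T.Near a ↔ T.Near d) := by
      have m : ∀ x ∈ T.H (i + 1), ∀ y ∈ T.H (i + 1), ¬ (T.Near x ↔ T.Near y) →
          (T.J (i + 1) x y ↔ T.α ≠ T.β) := by
        intro x hx y hy hxy
        by_cases hnx : T.Near x
        · exact hmix x hx y hy hnx (by tauto)
        · exact hmix' x hx y hy hnx (by tauto)
      have := m a ha b hb
      have := m b hb c hc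
      have := m c hc d hd
      have := m a ha c hc
      have := m b hb d hd
      have := m a ha d hd
      by_cases hE : T.α = T.β <;> by_cases T.Near a <;> by_cases T.Near b <;>
        by_cases T.Near c <;> by_cases T.Near d <;> simp_all
    by_cases hna : T.Near a
    · have hnb := hall.1.1 hna
      have hnc := hall.2.1.1 hna
      have hnd := hall.2.2.1 hna
      exact p4Free_adj hG hi a ha b hb c hc d hd (hnear a ha b hb hna hnb hab)
        (hnear b hb c hc hnb hnc hbc) (hnear c hc d hd hnc hnd hcd)
        (fun e => hac (J_of_adj _ e)) (fun e => hbd (J_of_adj _ e)) fun e => had (J_of_adj _ e)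
    · exact hstep a ⟨ha, hna⟩ b ⟨hb, fun e => hna (hall.1.2 e)⟩ c
        ⟨hc, fun e => hna (hall.2.1.2 e)⟩ d ⟨hd, fun e => hna (hall.2.2.2 e)⟩
        hab hbc hcd hac hbd had

/-! ### Colouring the part of the tower above a stable set -/

section Colouring

variable [Finite V] {w n : ℕ} (hw : ∀ K : Finset V, G.IsClique (K : Set V) → K.card ≤ w)
  (h1 : 1 ≤ w) (hn : ∀ X : Set V, G.SmallCliques w X → G.SetColorable X n)
include hw h1 hn

/-- Lower paths between vertices of `X` close up with upper paths of length two, three and four,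
which yields the conditions on the cover by neighbourhoods of vertices of `X`. -/
lemma setColorable_up {i : ℕ} (hi : i < T.k) {X : Set V} (hX : X ⊆ T.H i)
    (hst : ∀ x ∈ X, ∀ y ∈ X, ¬ G.Adj x y) (hP : P4Free (T.J i) X) :
    G.SetColorable {b ∈ T.Up i | ∃ a ∈ X, G.Adj a b} (2 * n) := by
  have hfin : X.Finite := Set.toFinite _
  have ne : ∀ a ∈ X, ∀ b ∈ T.Up i, a ≠ b := fun a ha b hb => T.ne_of_lev (by
    have := lev_up hi hb
    rw [T.lev_H _ _ (hX ha)]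
    omega)
  refine IsCover.setColorable (X := hfin.toFinset) (J := T.J i) (N := fun a => {b | G.Adj a b})
    (w := w) ⟨?_, ?_, ?_, ?_, ?_⟩ (fun _ _ h => h.symm) (fun a h => h.ne rfl) (by simpa) h1 hw hn
  · rintro b ⟨-, a, ha, hab⟩
    exact ⟨a, by simpa using ha, hab⟩
  · intro a ha c hc hJ b hb hab hcb
    simp only [Set.Finite.mem_toFinset] at ha hc
    have hac : G.Far a c := ⟨hJ.ne, hst a ha c hc⟩
    obtain ⟨l, hl, p⟩ := hJ
    have := even_add hG hi hac p ((IndPath.two hab hcb.symm hac).mono (by simpa using hb.1))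
    rw [Nat.even_iff] at this
    rw [Nat.odd_iff] at hl
    omega
  · intro a ha c hc hne hJ b hb b' hb' hbb' hab hcb hcb'
    simp only [Set.Finite.mem_toFinset] at ha hc
    by_contra hab'
    have hac : G.Far a c := ⟨hne, hst a ha c hc⟩
    obtain ⟨l, hl⟩ := exists_indPath_low hi (hX ha) (hX hc)
    have q := IndPath.three hab hbb' hcb'.symm ⟨ne a ha b' hb'.1, hab'⟩
      ⟨(ne c hc b hb.1).symm, fun e => hcb e.symm⟩ hac
    have h2 := even_add hG hi hac hl (q.mono (by
      rintro x (rfl | rfl)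
      exacts [hb.1, hb'.1]))
    rw [J_iff hG hi (hX ha) (hX hc) hl, Nat.odd_iff] at hJ
    rw [Nat.even_iff] at h2
    omega
  · intro a ha c hc hJ b₁ hb₁ b₂ hb₂ b₃ hb₃ h₁₂ h₂₃ h₁₃ hab₁ hcb₁ hcb₃ hab₃ hab₂
    simp only [Set.Finite.mem_toFinset] at ha hc
    by_contra hcb₂
    have hac : G.Far a c := ⟨hJ.ne, hst a ha c hc⟩
    obtain ⟨l, hl, p⟩ := hJ
    have q := IndPath.four hab₁ h₁₂ h₂₃ hcb₃.symm ⟨ne a ha b₂ hb₂.1, hab₂⟩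
      ⟨ne a ha b₃ hb₃.1, hab₃⟩ hac ⟨by rintro rfl; exact hab₃ hab₁, h₁₃⟩
      ⟨(ne c hc b₁ hb₁.1).symm, fun e => hcb₁ e.symm⟩
      ⟨(ne c hc b₂ hb₂.1).symm, fun e => hcb₂ e.symm⟩
    have h2 := even_add hG hi hac p (q.mono (by
      rintro x (rfl | rfl | rfl)
      exacts [hb₁.1, hb₂.1, hb₃.1]))
    rw [Nat.even_iff] at h2
    rw [Nat.odd_iff] at hl
    omega
  · intro a _ K hK hKc
    exact card_lt_of_common hw hKc fun x hx => (hK hx).1.symm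

/-- The part of `F` that is dominated by the last level of the tower has bounded chromatic
number. -/
theorem setColorable_F : G.SetColorable {f ∈ T.F | ∃ i, i + 1 = T.k ∧ ∃ a ∈ T.H i, G.Adj a f}
    (n * (2 * n) + (w - 1) * (2 * n) * (2 * n)) := by
  rcases Nat.lt_or_ge T.k 2 with hk | hk
  · refine setColorable_empty.mono ?_ (Nat.zero_le _)
    rintro f ⟨-, i, hi, a, ha, -⟩
    obtain ⟨j, rfl⟩ := pos_of_mem ha
    omega
  obtain ⟨i, hi⟩ : ∃ i, i + 2 = T.k := ⟨T.k - 2, by omega⟩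
  have hFU : T.F ⊆ T.Up (i + 1) := fun x hx => Or.inr hx
  have hnear : G.SetColorable {a ∈ T.H (i + 1) | T.Near a} n := by
    refine hn _ fun K hK hKc => card_lt_of_common hw hKc fun x hx =>
      (hK hx).2.adj (by omega) (hK hx).1
  have hfar : G.SetColorable {a ∈ T.H (i + 1) | ¬ T.Near a} ((w - 1) * (2 * n)) := by
    refine ((setColorable_H hG hw h1 (T := T) (i := i) (by omega)).dominated
      (F := {a ∈ T.H (i + 1) | ¬ T.Near a}) (q := 2 * n) ?_).mono ?_ le_rfl
    · intro X hX hst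
      refine (setColorable_up hG hw h1 hn (by omega) hX hst
        ((p4Free_J hG (by omega)).mono hX)).mono ?_ le_rfl
      rintro a ⟨⟨ha, hna⟩, hex⟩
      exact ⟨mem_up (by omega) ha hna, hex⟩
    · rintro a ⟨ha, hna⟩
      obtain ⟨p, hp, hap⟩ := T.parent i (by omega) a ha hna
      exact ⟨⟨ha, hna⟩, p, hp, hap.symm⟩
  have d1 := hnear.dominated (F := T.F) (q := 2 * n) (by
    intro X hX hst
    refine (setColorable_up hG hw h1 hn (i := i + 1) (by omega) (fun x hx => (hX hx).1) hst
      ?_).mono (fun f hf => ⟨hFU hf.1, hf.2⟩) le_rfl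
    intro a ha b hb c hc d hd hab
    exact absurd hab (not_J_of_common hG (by omega) (hX ha).1 (hX hb).1 (hst a ha b hb)
      (Or.inl ⟨_, by have := T.β_le; omega, rfl⟩) ((hX ha).2.adj (by omega) (hX ha).1)
      ((hX hb).2.adj (by omega) (hX hb).1)))
  have d2 := hfar.dominated (F := T.F) (q := 2 * n) (by
    intro X hX hst
    refine (setColorable_up hG hw h1 hn (i := i + 1) (by omega) (fun x hx => (hX hx).1) hst
      ?_).mono (fun f hf => ⟨hFU hf.1, hf.2⟩) le_rfl
    refine p4Free_J_step hG (by omega) (p4Free_J hG (by omega)) (fun x hx => (hX hx).1)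
      (fun x hx => (hX hx).2) (fun x hx y hy hxy => absurd hxy (hst x hx y hy)) ?_
    intro a ha b hb c hc d hd hab
    exact absurd hab (hst a ha b hb))
  refine (d1.union d2).mono ?_ le_rfl
  rintro f ⟨hf, j, hj, a, ha, haf⟩
  obtain rfl : j = i + 1 := by omega
  by_cases hna : T.Near a
  · exact Or.inl ⟨hf, a, ⟨ha, hna⟩, haf⟩
  · exact Or.inr ⟨hf, a, ⟨ha, hna⟩, haf⟩

end Colouring

end Tower

end SimpleGraph


/-! ### Covering a level by minimal sets -/

namespace SimpleGraph

variable {V : Type*} {G : SimpleGraph V}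

/-- Thin out the levels `R i` below `B ⊆ R k` so that each vertex is kept only for the sake of a
private child; only the vertices of `A` are required to have parents. -/
lemma exists_minimal_cover [Finite V] (R : ℕ → Set V) (A : Set V) {k : ℕ} {B : Set V}
    (hR : ∀ i < k, ∀ x ∈ R (i + 1), x ∈ A → ∃ p ∈ R i, G.Adj x p) (hB : B ⊆ R k) :
    ∃ C : ℕ → Set V, C k = B ∧ (∀ i ≤ k, C i ⊆ R i) ∧
      (∀ i < k, ∀ x ∈ C (i + 1), x ∈ A → ∃ p ∈ C i, G.Adj x p) ∧
      ∀ i < k, ∀ x ∈ C i, ∃ y ∈ C (i + 1), y ∈ A ∧ G.Adj x y ∧ ∀ z ∈ C i, G.Adj z y → z = x := by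
  induction k generalizing B with
  | zero =>
    refine ⟨fun _ => B, rfl, fun i hi => ?_, by simp, by simp⟩
    obtain rfl : i = 0 := by omega
    exact hB
  | succ k ih =>
    let S : Set (Set V) := {P | P ⊆ R k ∧ ∀ x ∈ B, x ∈ A → ∃ p ∈ P, G.Adj x p}
    obtain ⟨P, hP⟩ := (Set.toFinite S).exists_minimal
      ⟨R k, subset_rfl, fun x hx hxA => hR k (by omega) x (hB hx) hxA⟩
    obtain ⟨C, h1, h2, h3, h4⟩ := ih (fun i hi => hR i (by omega)) hP.1.1
    refine ⟨fun i => if i ≤ k then C i else B, by simp, fun i hi => ?_, fun i hi x hx hxA => ?_,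
      fun i hi x hx => ?_⟩
    · rcases Nat.lt_or_ge k i with h | h
      · obtain rfl : i = k + 1 := by omega
        simpa using hB
      · simpa [h] using h2 i h
    · have hik : i ≤ k := by omega
      simp only [hik, if_true]
      rcases hik.lt_or_eq with h | rfl
      · simp only [show i + 1 ≤ k by omega, if_true] at hx
        exact h3 i h x hx hxA
      · simp only [Nat.not_succ_le_self, if_false] at hx
        rw [h1]
        exact hP.1.2 x hx hxA
    · have hik : i ≤ k := by omega
      simp only [hik, if_true] at hx ⊢
      rcases hik.lt_or_eq with h | rfl
      · simp only [show i + 1 ≤ k by omega, if_true]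
        exact h4 i h x hx
      · simp only [Nat.not_succ_le_self, if_false]
        rw [h1] at hx ⊢
        by_contra! hcon
        have : P ⊆ P \ {x} := hP.2 ⟨Set.sdiff_subset.trans hP.1.1, fun y hy hyA => by
          obtain ⟨p, hp, hyp⟩ := hP.1.2 y hy hyA
          rcases eq_or_ne p x with rfl | hpx
          · obtain ⟨z, hz, hzy, hzx⟩ := hcon y hy hyA hyp.symm
            exact ⟨z, ⟨hz, hzx⟩, hzy.symm⟩
          · exact ⟨p, ⟨hp, hpx⟩, hyp⟩⟩ Set.sdiff_subset
        exact (this hx).2 rfl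

lemma Joined.within {U : Set V} {a x : V} (h : G.Joined U a x) :
    G.Joined {x ∈ U | G.Joined U a x} a x := by
  induction h with
  | refl => exact Joined.refl _
  | @tail b c hab hbc ih =>
    exact ih.trans (Joined.of_adj hbc.1 ⟨hbc.2.1, hab⟩ ⟨hbc.2.2, hab.tail hbc⟩)

/-! ### Splitting into towers -/

/-- The vertices of `C i` from which one can descend through the sets `C j`, off the neighbourhood
of the spine, to a vertex attached to the spine in the manner prescribed by `α`, `β` and `ε`. -/
def Typed (G : SimpleGraph V) (C : ℕ → Set V) (k : ℕ) (s : ℕ → V) (α β ε : ℕ) : ℕ → Set V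
  | 0 => ∅
  | i + 1 => {x ∈ C (i + 1) | x ≠ s (i + 1) ∧
      (((∃ j < k, G.Adj x (s j)) ∧
          (∀ j < k, (G.Adj x (s j) ↔ i + 1 + α ≤ j + 1 ∧ j + 1 ≤ i + 1 + β)) ∧
          (α ≠ β → (i + 1) % 2 = ε)) ∨
        (¬ ∃ j < k, G.Adj x (s j)) ∧ ∃ p ∈ Typed G C k s α β ε i, G.Adj x p)}

lemma Typed.mem {C : ℕ → Set V} {k : ℕ} {s : ℕ → V} {α β ε i : ℕ} {x : V}
    (h : x ∈ Typed G C k s α β ε i) : x ∈ C i ∧ x ≠ s i := by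
  rcases i with _ | i
  · exact absurd h (Set.notMem_empty _)
  · exact ⟨h.1, h.2.1⟩

section Towers

variable [Finite V] (hG : ¬ G.HasOddHole) {w n : ℕ}
  (hw : ∀ K : Finset V, G.IsClique (K : Set V) → K.card ≤ w) (h1 : 1 ≤ w)
  (hn : ∀ X : Set V, G.SmallCliques w X → G.SetColorable X n)

include hG hw h1 hn in
/-- The vertices of `F` dominated by vertices of a fixed type lie above a tower. -/
lemma setColorable_typed (lev : V → ℕ) (lev_le : ∀ x y, G.Adj x y → lev x ≤ lev y + 1) {k : ℕ}
    {s : ℕ → V} (lev_s : ∀ i ≤ k, lev (s i) = i) (adj_s : ∀ i < k, G.Adj (s i) (s (i + 1)))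
    {C : ℕ → Set V} (lev_C : ∀ i ≤ k, ∀ x ∈ C i, lev x = i)
    {F : Set V} (hF : F ⊆ C k) (joined_F : ∀ x ∈ F, ∀ y ∈ F, G.Joined F x y)
    (not_adj_F : ∀ j < k, ∀ x ∈ F, ¬ G.Adj x (s j)) (adj_F : ∃ x ∈ F, G.Adj x (s k))
    {α β : ℕ} (ε : ℕ) (hαβ : α ≤ β) (hβ : β ≤ 1) :
    G.SetColorable {f ∈ F | ∃ i, i + 1 = k ∧ ∃ a ∈ Typed G C k s α β ε i, G.Adj a f}
      (n * (2 * n) + (w - 1) * (2 * n) * (2 * n)) := by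
  rcases k with _ | k
  · refine setColorable_empty.mono ?_ (Nat.zero_le _)
    rintro f ⟨-, i, hi, -⟩
    omega
  obtain ⟨D, hDk, hDT, hDpar, hDchild⟩ := exists_minimal_cover (G := G)
    (Typed G C (k + 1) s α β ε) {x | ¬ ∃ j < k + 1, G.Adj x (s j)} (k := k)
    (B := {a ∈ Typed G C (k + 1) s α β ε k | ∃ f ∈ F, G.Adj a f})
    (fun i _ x hx hxA => by
      rcases hx.2.2 with h | h
      · exact absurd h.1 hxA
      · exact h.2) (fun a ha => ha.1)
  have hmem : ∀ i, ∀ x ∈ (if i < k + 1 then D i else ∅ : Set V), i < k + 1 ∧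
      x ∈ Typed G C (k + 1) s α β ε i := by
    intro i x hx
    by_cases h : i < k + 1
    · simp only [h, if_true] at hx
      exact ⟨h, hDT i (by omega) hx⟩
    · simp [h] at hx
  let T : Tower G :=
    { lev := lev
      lev_le := lev_le
      k := k + 1
      s := s
      lev_s := lev_s
      adj_s := adj_s
      H := fun i => if i < k + 1 then D i else ∅
      H_zero := Set.eq_empty_of_forall_notMem fun x hx => (hmem 0 x hx).2
      lev_H := fun i x hx => lev_C i (hmem i x hx).1.le x (Typed.mem (hmem i x hx).2).1
      ne_s := fun i _ x hx => (Typed.mem (hmem i x hx).2).2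
      F := F
      lev_F := fun x hx => lev_C _ le_rfl x (hF hx)
      joined_F := joined_F
      not_adj_F := not_adj_F
      adj_F := adj_F
      α := α
      β := β
      ε := ε
      α_le := hαβ
      β_le := hβ
      near_iff := fun i _ x hx hnx => by
        have h := (hmem i x hx).2
        rcases i with _ | i
        · exact absurd h (Set.notMem_empty _)
        · rcases h.2.2 with h | h
          · exact h.2.1
          · exact absurd hnx h.1
      near_parity := fun i _ x hx hnx => by
        have h := (hmem i x hx).2
        rcases i with _ | i
        · exact absurd h (Set.notMem_empty _)
        · rcases h.2.2 with h | h
          · exact h.2.2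
          · exact absurd hnx h.1
      parent := fun i hi x hx hnx => by
        simp only [hi, show i < k + 1 by omega, if_true] at hx ⊢
        exact hDpar i (by omega) x hx hnx
      child := fun i hi x hx => by
        simp only [hi, show i < k + 1 by omega, if_true] at hx ⊢
        exact hDchild i (by omega) x hx
      top := fun i hi x hx => by
        obtain rfl : i = k := by omega
        simp only [Nat.lt_succ_self, if_true] at hx
        rw [hDk] at hx
        exact hx.2 }
  refine (T.setColorable_F hG hw h1 hn).mono ?_ le_rfl
  rintro f ⟨hf, i, hi, a, ha, haf⟩
  refine ⟨hf, i, hi, a, ?_, haf⟩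
  obtain rfl : i = k := by omega
  change a ∈ (if i < i + 1 then D i else ∅ : Set V)
  rw [if_pos (Nat.lt_succ_self _), hDk]
  exact ⟨ha, f, hf, haf⟩

include hG hw h1 hn in
/-- If every spine vertex is a private child of its predecessor, then there are four types of
vertices, and each vertex of `F` is dominated by a vertex of one of them. -/
lemma setColorable_of_spine (lev : V → ℕ) (lev_le : ∀ x y, G.Adj x y → lev x ≤ lev y + 1) {k : ℕ}
    (hk : 1 ≤ k) {s : ℕ → V} (lev_s : ∀ i ≤ k, lev (s i) = i)
    (adj_s : ∀ i < k, G.Adj (s i) (s (i + 1)))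
    {C : ℕ → Set V} (lev_C : ∀ i ≤ k, ∀ x ∈ C i, lev x = i) (C_zero : ∀ x ∈ C 0, x = s 0)
    (parent : ∀ i < k, ∀ x ∈ C (i + 1), ∃ p ∈ C i, G.Adj x p)
    (priv : ∀ i, i + 1 < k → ∀ x ∈ C i, G.Adj x (s (i + 1)) → x = s i)
    {F : Set V} (hF : F ⊆ C k) (joined_F : ∀ x ∈ F, ∀ y ∈ F, G.Joined F x y)
    (not_adj_F : ∀ j < k, ∀ x ∈ F, ¬ G.Adj x (s j)) (adj_F : ∃ x ∈ F, G.Adj x (s k)) :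
    G.SetColorable F (4 * (n * (2 * n) + (w - 1) * (2 * n) * (2 * n))) := by
  -- the types `(0, 0)`, `(1, 1)`, and `(0, 1)` for either parity of the level
  let α : ℕ → ℕ := fun t => if t = 1 then 1 else 0
  let β : ℕ → ℕ := fun t => if t = 0 then 0 else 1
  let ε : ℕ → ℕ := fun t => t - 2
  have key : ∀ i < k, ∀ x ∈ C i, x ≠ s i →
      ∃ t < 4, x ∈ Typed G C k s (α t) (β t) (ε t) i := by
    intro i
    induction i with
    | zero => exact fun _ x hx hxs => absurd (C_zero x hx) hxs
    | succ i ih =>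
      intro hi x hx hxs
      by_cases hnx : ∃ j < k, G.Adj x (s j)
      · have hlev := lev_C _ hi.le x hx
        -- by the levels and privacy, `x` can only be adjacent to `s i` and `s (i + 1)`
        have hj : ∀ j < k, G.Adj x (s j) → j = i ∨ j = i + 1 := by
          intro j hj hxj
          have e1 := lev_le _ _ hxj
          have e2 := lev_le _ _ hxj.symm
          rw [lev_s j hj.le, hlev] at e1 e2
          have : j ≠ i + 2 := by
            rintro rfl
            exact hxs (priv (i + 1) hj x hx hxj)
          omega
        have hcase : ∃ t < 4, (∀ j < k, (G.Adj x (s j) ↔ i + 1 + α t ≤ j + 1 ∧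
            j + 1 ≤ i + 1 + β t)) ∧ (α t ≠ β t → (i + 1) % 2 = ε t) := by
          have e : ∀ α β, (G.Adj x (s i) ↔ α = 0) → (G.Adj x (s (i + 1)) ↔ β = 1) → β ≤ 1 →
              α ≤ 1 → ∀ j < k, (G.Adj x (s j) ↔ i + 1 + α ≤ j + 1 ∧ j + 1 ≤ i + 1 + β) := by
            intro α β hα hβ h1 h2 j hjk
            constructor
            · intro h
              rcases hj j hjk h with rfl | rfl
              · have := hα.1 h
                omega
              · have := hβ.1 h
                omega
            · rintro ⟨h3, h4⟩
              rcases (by omega : j = i ∨ j = i + 1) with rfl | rfl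
              · exact hα.2 (by omega)
              · exact hβ.2 (by omega)
          by_cases hx1 : G.Adj x (s i) <;> by_cases hx2 : G.Adj x (s (i + 1))
          · rcases Nat.mod_two_eq_zero_or_one (i + 1) with h | h
            · exact ⟨2, by simp, e _ _ (by simp [α, hx1]) (by simp [β, hx2]) (by simp [β])
                (by simp [α]), fun _ => by simp [ε, h]⟩
            · exact ⟨3, by simp, e _ _ (by simp [α, hx1]) (by simp [β, hx2]) (by simp [β])
                (by simp [α]), fun _ => by simp [ε, h]⟩
          · exact ⟨0, by simp, e _ _ (by simp [α, hx1]) (by simp [β, hx2]) (by simp [β])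
              (by simp [α]), by simp [α, β]⟩
          · exact ⟨1, by simp, e _ _ (by simp [α, hx1]) (by simp [β, hx2]) (by simp [β])
              (by simp [α]), by simp [α, β]⟩
          · obtain ⟨j, hjk, hxj⟩ := hnx
            rcases hj j hjk hxj with rfl | rfl <;> contradiction
        obtain ⟨t, ht, h2, h3⟩ := hcase
        exact ⟨t, ht, hx, hxs, Or.inl ⟨hnx, h2, h3⟩⟩
      · obtain ⟨p, hp, hxp⟩ := parent i (by omega) x hx
        obtain ⟨t, ht, hpt⟩ := ih (by omega) p hp
          (by rintro rfl; exact hnx ⟨i, by omega, hxp⟩)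
        exact ⟨t, ht, hx, hxs, Or.inr ⟨hnx, p, hpt, hxp⟩⟩
  refine SetColorable.of_iUnion (Y := fun t => {f ∈ F | ∃ i, i + 1 = k ∧
    ∃ a ∈ Typed G C k s (α t) (β t) (ε t) i, G.Adj a f}) ?_ fun t _ =>
      setColorable_typed hG hw h1 hn lev lev_le lev_s adj_s lev_C hF joined_F not_adj_F adj_F _ ?_ ?_
  · intro f hf
    obtain ⟨k, rfl⟩ : ∃ j, k = j + 1 := ⟨k - 1, by omega⟩
    obtain ⟨p, hp, hfp⟩ := parent k (by omega) f (hF hf)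
    obtain ⟨t, ht, hpt⟩ := key k (by omega) p hp
      (by rintro rfl; exact not_adj_F k (by omega) f hf hfp)
    exact ⟨t, ht, hf, k, rfl, p, hpt, hfp.symm⟩
  · simp only [α, β]
    split_ifs <;> omega
  · simp only [β]
    split_ifs <;> omega

include hG hw h1 hn in
/-- A connected set on a level of a levelling with a single root has bounded chromatic number. -/
lemma setColorable_of_joined_level (lev : V → ℕ)
    (lev_le : ∀ x y, G.Adj x y → lev x ≤ lev y + 1) {R : ℕ → Set V}
    (lev_R : ∀ i, ∀ x ∈ R i, lev x = i) (R_zero : ∀ x ∈ R 0, ∀ y ∈ R 0, x = y)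
    (hR : ∀ i, ∀ x ∈ R (i + 1), ∃ p ∈ R i, G.Adj x p) {k : ℕ} {B : Set V}
    (hB : B ⊆ R (k + 1)) (hBj : ∀ x ∈ B, ∀ y ∈ B, G.Joined B x y) :
    G.SetColorable B (n + 4 * (n * (2 * n) + (w - 1) * (2 * n) * (2 * n))) := by
  classical
  rcases B.eq_empty_or_nonempty with rfl | hBne
  · exact setColorable_empty.mono subset_rfl (Nat.zero_le _)
  obtain ⟨C, hCk, hCR, hCpar, hCchild⟩ := exists_minimal_cover (G := G) R Set.univ (k := k + 1)
    (fun i _ x hx _ => hR i x hx) hB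
  have hC0 : ∀ i ≤ k + 1, (C i).Nonempty → (C 0).Nonempty := by
    intro i
    induction i with
    | zero => exact fun _ h => h
    | succ i ih =>
      rintro hi ⟨x, hx⟩
      obtain ⟨p, hp, -⟩ := hCpar i (by omega) x hx (Set.mem_univ x)
      exact ih (by omega) ⟨p, hp⟩
  obtain ⟨r, hr⟩ := hC0 (k + 1) le_rfl (hCk ▸ hBne)
  simp only [Set.mem_univ, true_and] at hCchild
  choose! g hg1 hg2 hg3 using hCchild
  -- the spine: each vertex is a private child of the one before
  let s : ℕ → V := fun i => Nat.rec (motive := fun _ => V) r (fun i v => g i v) i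
  have s_succ : ∀ i, s (i + 1) = g i (s i) := fun i => rfl
  have hs : ∀ i ≤ k + 1, s i ∈ C i := by
    intro i
    induction i with
    | zero => exact fun _ => hr
    | succ i ih =>
      intro hi
      rw [s_succ]
      exact hg1 i (by omega) _ (ih (by omega))
  have hs_adj : ∀ i < k + 1, G.Adj (s i) (s (i + 1)) := fun i hi => by
    rw [s_succ]
    exact hg2 i hi _ (hs i hi.le)
  have e1 : G.SetColorable {x ∈ B | G.Adj x (s k)} n :=
    hn _ fun K hK hKc => card_lt_of_common hw hKc fun x hx => (hK hx).2
  have e2 : G.SetColorable {x ∈ B | ¬ G.Adj x (s k)}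
      (4 * (n * (2 * n) + (w - 1) * (2 * n) * (2 * n))) := by
    refine SetColorable.of_components fun a ha => ?_
    set B' : Set V := {x ∈ B | ¬ G.Adj x (s k)} with hB'
    set F : Set V := {x ∈ B' | G.Joined B' a x} with hF
    -- walking from `a` to `s (k + 1)` inside `B`, one leaves `F` at a neighbour of `s k`
    have hd : ∀ x, G.Joined B a x → x ∈ F ∨ ∃ d ∈ B, G.Adj d (s k) ∧ ∃ f ∈ F, G.Adj f d := by
      intro x hx
      induction hx with
      | refl => exact Or.inl ⟨ha, Joined.refl _⟩
      | @tail x y _ hxy ih =>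
        rcases ih with h | h
        · by_cases hy : G.Adj y (s k)
          · exact Or.inr ⟨y, hxy.2.2, hy, x, h, hxy.1⟩
          · exact Or.inl ⟨⟨hxy.2.2, hy⟩, h.2.trans (Joined.of_adj hxy.1 h.1 ⟨hxy.2.2, hy⟩)⟩
        · exact Or.inr h
    obtain ⟨d, hdB, hds, hdF⟩ := (hd (s (k + 1)) (hBj a ha.1 _ (hCk ▸ hs _ le_rfl))).resolve_left
      fun h => h.1.2 (hs_adj k (by omega)).symm
    let s' : ℕ → V := fun i => if i ≤ k then s i else d
    have hs' : ∀ i ≤ k, s' i = s i := fun i hi => if_pos hi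
    have hs'k : s' (k + 1) = d := if_neg (by omega)
    have lev_C : ∀ i ≤ k + 1, ∀ x ∈ C i, lev x = i := fun i hi x hx => lev_R i x (hCR i hi hx)
    refine setColorable_of_spine hG hw h1 hn lev lev_le (k := k + 1) (by omega) (s := s') (C := C)
      ?_ ?_ lev_C ?_ (fun i hi x hx => hCpar i hi x hx (Set.mem_univ x)) ?_ ?_ ?_ ?_ ?_
    · intro i hi
      rcases hi.lt_or_eq with h | rfl
      · rw [hs' i (by omega)]
        exact lev_C i hi _ (hs i hi)
      · rw [hs'k]
        exact lev_R _ d (hB hdB)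
    · intro i hi
      rw [hs' i (by omega)]
      rcases (by omega : i < k ∨ i = k) with h | rfl
      · rw [hs' (i + 1) (by omega)]
        exact hs_adj i hi
      · rw [hs'k]
        exact hds.symm
    · intro x hx
      rw [hs' 0 (by omega)]
      exact R_zero x (hCR 0 (by omega) hx) _ (hCR 0 (by omega) (hs 0 (by omega)))
    · intro i hi x hx hxs
      rw [hs' (i + 1) (by omega), s_succ] at hxs
      rw [hs' i (by omega)]
      exact hg3 i (by omega) _ (hs i (by omega)) x hx hxs
    · exact fun x hx => hCk ▸ hx.1.1
    · exact fun x hx y hy => (hx.2.within).symm.trans (hy.2.within)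
    · intro j hj x hx hxj
      rw [hs' j (by omega)] at hxj
      rcases (by omega : j < k ∨ j = k) with h | rfl
      · have := lev_le _ _ hxj
        rw [lev_R _ x (hB hx.1.1), lev_C j (by omega) _ (hs j (by omega))] at this
        omega
      · exact hx.1.2 hxj
    · rw [hs'k]
      exact hdF
  refine (e1.union e2).mono (fun x hx => ?_) le_rfl
  by_cases h : G.Adj x (s k)
  · exact Or.inl ⟨hx, h⟩
  · exact Or.inr ⟨hx, h⟩

end Towers

/-! ### Levels by distance -/

/-- If all the distance levels of a component are `q`-colourable, the component is
`2q`-colourable. -/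
lemma setColorable_of_levels {r : V} {q : ℕ}
    (h : ∀ i, G.SetColorable {x | G.Reachable r x ∧ G.dist r x = i} q) :
    G.SetColorable {x | G.Reachable r x} (2 * q) := by
  choose c h1 h2 using h
  refine ⟨fun x => G.dist r x % 2 * q + c (G.dist r x) x, fun x hx => ?_, fun x hx y hy hxy he => ?_⟩
  · have := h1 _ x ⟨hx, rfl⟩
    rcases Nat.mod_two_eq_zero_or_one (G.dist r x) with e | e <;> simp only [e] <;> omega
  · have e1 := h1 _ x ⟨hx, rfl⟩
    have e2 := h1 _ y ⟨hy, rfl⟩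
    have hd := hxy.diff_dist_adj (u := r)
    by_cases heq : G.dist r y = G.dist r x
    · have := h2 _ x ⟨hx, rfl⟩ y ⟨hy, heq⟩ hxy
      simp only [heq] at he
      omega
    · rcases Nat.mod_two_eq_zero_or_one (G.dist r x) with e | e <;>
        rcases Nat.mod_two_eq_zero_or_one (G.dist r y) with e' | e' <;>
        simp only [e, e'] at he <;> omega

/-- One step of the recursion for the chromatic number: from clique number below `w` to `w`. -/
theorem setColorable_univ_step [Finite V] (hG : ¬ G.HasOddHole) {w n : ℕ} (h2 : 2 ≤ w)
    (hw : ∀ K : Finset V, G.IsClique (K : Set V) → K.card ≤ w)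
    (hn : ∀ X : Set V, G.SmallCliques w X → G.SetColorable X n) :
    G.SetColorable Set.univ
      (2 * (n + 4 * (n * (2 * n) + (w - 1) * (2 * n) * (2 * n)))) := by
  refine SetColorable.of_components fun r _ => ?_
  have hreach : ∀ x, G.Joined Set.univ r x → G.Reachable r x := by
    intro x hx
    induction hx with
    | refl => exact Reachable.refl _
    | tail _ h ih => exact ih.trans h.1.reachable
  refine (setColorable_of_levels (r := r) fun i => ?_).mono (fun x hx => hreach x hx.2) le_rfl
  have lev_le : ∀ x y, G.Adj x y → G.dist r x ≤ G.dist r y + 1 := fun x y hxy => by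
    have := hxy.diff_dist_adj (u := r)
    omega
  rcases i with _ | k
  · refine (hn _ fun K hK _ => ?_).mono subset_rfl (Nat.le_add_right _ _)
    have : K.card ≤ 1 := Finset.card_le_one.2 fun a ha b hb =>
      ((hK ha).1.dist_eq_zero_iff.1 (hK ha).2).symm.trans
        ((hK hb).1.dist_eq_zero_iff.1 (hK hb).2)
    omega
  · refine SetColorable.of_components fun a ha => ?_
    refine setColorable_of_joined_level hG hw (by omega) hn (G.dist r) lev_le
      (R := fun i => {x | G.Reachable r x ∧ G.dist r x = i}) (fun i x hx => hx.2) ?_ ?_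
      (fun x hx => hx.1) fun x hx y hy => (hx.2.within).symm.trans (hy.2.within)
    · exact fun x hx y hy => (hx.1.dist_eq_zero_iff.1 hx.2).symm.trans
        (hy.1.dist_eq_zero_iff.1 hy.2)
    · rintro i x ⟨hx, hxi⟩
      obtain ⟨p, hp⟩ := hx.symm.exists_walk_length_eq_dist
      rw [dist_comm, hxi] at hp
      cases p with
      | nil => simp at hp
      | @cons _ y _ hxy p =>
        simp only [Walk.length_cons, Nat.add_right_cancel_iff] at hp
        refine ⟨y, ⟨p.reachable.symm, ?_⟩, hxy⟩
        have h3 := lev_le x y hxy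
        have h4 := dist_le p
        rw [dist_comm] at h4
        omega

/-! ### The bound -/

/-- The number of colours that the recursion yields for cliques of size at most `k + 1`. -/
def holeBound : ℕ → ℕ
  | 0 => 1
  | k + 1 => 32 * (k + 2) * holeBound k ^ 2

lemma holeBound_pos (k : ℕ) : 0 < holeBound k := by
  induction k with
  | zero => exact one_pos
  | succ k ih =>
    rw [holeBound]
    positivity

lemma holeBound_le (k : ℕ) : 32 * (k + 4) * holeBound k ≤ 2 ^ 2 ^ (k + 3) := by
  induction k with
  | zero => norm_num [holeBound]
  | succ k ih =>
    have e : 2 ^ 2 ^ (k + 1 + 3) = (2 ^ 2 ^ (k + 3)) ^ 2 := by rw [← pow_mul, ← pow_succ]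
    calc 32 * (k + 1 + 4) * holeBound (k + 1)
        = (32 * holeBound k) ^ 2 * ((k + 5) * (k + 2)) := by rw [holeBound]; ring
      _ ≤ (32 * holeBound k) ^ 2 * (k + 4) ^ 2 := Nat.mul_le_mul_left _ (by nlinarith)
      _ = (32 * (k + 4) * holeBound k) ^ 2 := by ring
      _ ≤ (2 ^ 2 ^ (k + 3)) ^ 2 := Nat.pow_le_pow_left ih 2
      _ = _ := e.symm

theorem setColorable_holeBound (k : ℕ) {V : Type*} [Finite V] {G : SimpleGraph V}
    (hG : ¬ G.HasOddHole) (hw : ∀ K : Finset V, G.IsClique (K : Set V) → K.card ≤ k + 1) :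
    G.SetColorable Set.univ (holeBound k) := by
  classical
  induction k generalizing V with
  | zero =>
    refine ⟨fun _ => 0, fun _ _ => one_pos, fun x _ y _ hxy => ?_⟩
    have := hw {x, y} (by simpa using fun _ => hxy)
    rw [Finset.card_pair hxy.ne] at this
    omega
  | succ k ih =>
    refine (setColorable_univ_step hG (w := k + 2) (n := holeBound k) (by omega) hw ?_).mono
      subset_rfl ?_
    · intro X hX
      obtain ⟨c, h1, h2⟩ := ih (V := X) (G := G.induce X)
        (fun ⟨m, h5, hodd, h⟩ => hG ⟨m, h5, hodd, h.trans ⟨Embedding.induce X⟩⟩) (by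
          intro K hK
          have := hX (K.map (Function.Embedding.subtype _)) (by simp) (by
            intro x hx y hy hxy
            simp only [Finset.coe_map, Set.mem_image, Finset.mem_coe] at hx hy
            obtain ⟨x, hx, rfl⟩ := hx
            obtain ⟨y, hy, rfl⟩ := hy
            exact hK hx hy fun e => hxy (e ▸ rfl))
          rw [Finset.card_map] at this
          omega)
      refine ⟨fun v => if h : v ∈ X then c ⟨v, h⟩ else 0, fun x hx => ?_, fun x hx y hy hxy => ?_⟩
      · simpa [hx] using h1 ⟨x, hx⟩ (Set.mem_univ _)
      · simpa [hx, hy] using h2 ⟨x, hx⟩ (Set.mem_univ _) ⟨y, hy⟩ (Set.mem_univ _) hxy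
    · rw [holeBound]
      have := holeBound_pos k
      have e : k + 2 - 1 = k + 1 := by omega
      rw [e]
      nlinarith

lemma SetColorable.colorable {q : ℕ} (h : G.SetColorable Set.univ q) : G.Colorable q := by
  obtain ⟨c, h1, h2⟩ := h
  exact ⟨Coloring.mk (fun v => ⟨c v, h1 v (Set.mem_univ v)⟩) fun {x y} hxy e =>
    h2 x (Set.mem_univ x) y (Set.mem_univ y) hxy (Fin.mk.inj_iff.1 e)⟩

end SimpleGraph

theorem mainTheorem1 {V : Type*} [Finite V] (G : SimpleGraph V) (hG : ¬ G.HasOddHole) :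
    G.chromaticNumber ≤ ((2 ^ 2 ^ (G.cliqueNum + 2) : ℕ) : ℕ∞) := by
  have hw : ∀ K : Finset V, G.IsClique (K : Set V) → K.card ≤ G.cliqueNum := fun K hK =>
    hK.card_le_cliqueNum
  have hcol := (SimpleGraph.setColorable_holeBound (G.cliqueNum - 1) hG fun K hK => by
    have := hw K hK
    omega).colorable
  refine (hcol.mono ?_).chromaticNumber_le
  rcases Nat.eq_zero_or_pos G.cliqueNum with h | h
  · rw [h]
    norm_num [SimpleGraph.holeBound]
  · have hb := SimpleGraph.holeBound_le (G.cliqueNum - 1)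
    rw [show G.cliqueNum - 1 + 3 = G.cliqueNum + 2 by omega] at hb
    exact (Nat.le_mul_of_pos_left _ (by omega)).trans hb
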